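/- Let $\mathbb{K}\in\{\mathbb{R},\mathbb{C}\}$. For $m,n\in\mathbb{N}$ let $\mathscr{O}^m_n(\mathbb{R})$ be the normed space of all $f\in C^m(\mathbb{R})$ with values in $\mathbb{K}$ such that $$|f|_{m,n}:=\sup_{x\in\mathbb{R},\,0\le j\le m}(1+|x|^2)^{-n}|f^{(j)}(x)|<\infty ,$$ let $\mathscr{O}^m(\mathbb{R})=\bigcup_n\mathscr{O}^m_n(\mathbb{R})$ carry the locally convex inductive limit topology of the spaces $\mathscr{O}^m_n(\mathbb{R})$, $n\in\mathbb{N}$, and let $\mathscr{O}_M(\mathbb{R})=\bigcap_m\mathscr{O}^m(\mathbb{R})$ carry the projective limit topology, i.e. the coarsest topology that makes all inclusions $\mathscr{O}_M(\mathbb{R})\to\mathscr{O}^m(\mathbb{R})$ continuous. Let $\mathscr{S}(\mathbb{R})$ be the Schwartz space of $\mathbb{K}$-valued rapidly decreasing smooth functions. A map $T\colon X\to X$ of a topological space is called mixing if for all non-empty open $U,V\subseteq X$ there is $N$ such that $T^n(U)\cap V\neq\emptyset$ for all $n\ge N$. For a bijection $\psi\colon\mathbb{R}\to\mathbb{R}$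 and $n\in\mathbb{N}$ let $\psi_n$ be the $n$-fold composition of $\psi$ with itself and $\psi_{-n}$ the inverse function of $\psi_n$; for $a\in\mathbb{R}$ put $I_a=[\min\{a,\psi(a)\},\max\{a,\psi(a)\}]$. **Theorem.** Let $\psi\colon\mathbb{R}\to\mathbb{R}$ be a surjective, real-valued function in $\mathscr{O}_M(\mathbb{R})$. Then the following conditions are equivalent. (i) The composition operator $C_\psi\colon\mathscr{O}_M(\mathbb{R})\to\mathscr{O}_M(\mathbb{R})$, $f\mapsto f\circ\psi$, is mixing. (ii) $\psi$ is injective, has a non-vanishing derivative and no fixed points, and for every $a\in\mathbb{R}$, every integer $k\ge 1$ and every $v\in\mathscr{S}(\mathbb{R})$ $$\lim_{n\to\infty}\ \sup_{x\in\psi_{-n}(I_a)}\left|v(x)(\psi_n)^{(k)}(x)\right|=0\quad\text{and}\quad \lim_{n\to\infty}\ \sup_{x\in\psi_{n}(I_a)}\left|v(x)(\psi_{-n})^{(k)}(x)\right|=0 .$$ (iii) $\psi$ is injective, has a non-vanishing derivative and no fixed points, and there are $a,b\in\mathbb{R}$ such that for every integer $k\ge 1$ and every $v\in\mathscr{S}(\mathbb{R})$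 $$\lim_{n\to\infty}\ \sup_{x\in\psi_{-n}(I_a)}\left|v(x)(\psi_n)^{(k)}(x)\right|=0\quad\text{and}\quad \lim_{n\to\infty}\ \sup_{x\in\psi_{n}(I_b)}\left|v(x)(\psi_{-n})^{(k)}(x)\right|=0 .$$ -/

import Mathlib

open scoped SchwartzMap ContDiff Topology

noncomputable section

namespace SlowlyIncreasing

/-- The space `𝒪ₙᵐ(ℝ)`: functions `f ∈ Cᵐ(ℝ)` with
`sup_{x ∈ ℝ, 0 ≤ j ≤ m} (1 + |x|²)⁻ⁿ |f⁽ʲ⁾(x)| < ∞`. -/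
def stepSubmodule (𝕜 : Type*) [RCLike 𝕜] (m n : ℕ) : Submodule 𝕜 (ℝ → 𝕜) where
  carrier := {f | ContDiff ℝ m f ∧
    ∃ C : ℝ, ∀ x : ℝ, ∀ j ≤ m, ((1 + |x| ^ 2) ^ n)⁻¹ * ‖iteratedDeriv j f x‖ ≤ C}
  zero_mem' := by
    refine ⟨contDiff_const, 0, fun x j _ => ?_⟩
    have h : iteratedDeriv j (0 : ℝ → 𝕜) x = 0 := by
      simp [iteratedDeriv_eq_iteratedFDeriv]
    simp [h]
  add_mem' := by
    rintro f g ⟨hf, C, hC⟩ ⟨hg, D, hD⟩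
    refine ⟨hf.add hg, C + D, fun x j hj => ?_⟩
    have hj' : (j : WithTop ℕ∞) ≤ m := by exact_mod_cast hj
    rw [iteratedDeriv_add (hf.of_le hj').contDiffAt (hg.of_le hj').contDiffAt]
    have h1 := hC x j hj
    have h2 := hD x j hj
    have h3 : 0 ≤ ((1 + |x| ^ 2) ^ n)⁻¹ := by positivity
    have h4 := mul_le_mul_of_nonneg_left
      (norm_add_le (iteratedDeriv j f x) (iteratedDeriv j g x)) h3
    rw [mul_add] at h4
    linarith
  smul_mem' := by
    rintro c f ⟨hf, C, hC⟩
    refine ⟨hf.const_smul c, ‖c‖ * C, fun x j hj => ?_⟩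
    have hj' : (j : WithTop ℕ∞) ≤ m := by exact_mod_cast hj
    rw [iteratedDeriv_const_smul (hf.of_le hj').contDiffAt, norm_smul, mul_left_comm]
    exact mul_le_mul_of_nonneg_left (hC x j hj) (norm_nonneg c)

/-- `𝒪ₙᵐ(ℝ)` as a type of its own, so that it carries the topology of its norm and not the
topology of pointwise convergence. -/
def Step (𝕜 : Type*) [RCLike 𝕜] (m n : ℕ) : Type _ := stepSubmodule 𝕜 m n

instance (𝕜 : Type*) [RCLike 𝕜] (m n : ℕ) : AddCommGroup (Step 𝕜 m n) :=
  inferInstanceAs (AddCommGroup (stepSubmodule 𝕜 m n))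

instance (𝕜 : Type*) [RCLike 𝕜] (m n : ℕ) : Module 𝕜 (Step 𝕜 m n) :=
  inferInstanceAs (Module 𝕜 (stepSubmodule 𝕜 m n))

/-- `|f|_{m,n} = sup_{x ∈ ℝ, 0 ≤ j ≤ m} (1 + |x|²)⁻ⁿ |f⁽ʲ⁾(x)|`. -/
instance (𝕜 : Type*) [RCLike 𝕜] (m n : ℕ) : Norm (Step 𝕜 m n) where
  norm f := ⨆ p : ℝ × Fin (m + 1), ((1 + |p.1| ^ 2) ^ n)⁻¹ * ‖iteratedDeriv p.2 f.1 p.1‖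

theorem Step.bddAbove {𝕜 : Type*} [RCLike 𝕜] {m n : ℕ} (f : Step 𝕜 m n) :
    BddAbove (Set.range fun p : ℝ × Fin (m + 1) =>
      ((1 + |p.1| ^ 2) ^ n)⁻¹ * ‖iteratedDeriv p.2 f.1 p.1‖) := by
  obtain ⟨-, C, hC⟩ := f.2
  refine ⟨C, ?_⟩
  rintro _ ⟨p, rfl⟩
  exact hC p.1 p.2 (Nat.lt_succ_iff.1 p.2.2)

theorem Step.le_norm {𝕜 : Type*} [RCLike 𝕜] {m n : ℕ} (f : Step 𝕜 m n)
    (p : ℝ × Fin (m + 1)) :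
    ((1 + |p.1| ^ 2) ^ n)⁻¹ * ‖iteratedDeriv p.2 f.1 p.1‖ ≤ ‖f‖ :=
  le_ciSup f.bddAbove p

theorem Step.core (𝕜 : Type*) [RCLike 𝕜] (m n : ℕ) : NormedSpace.Core 𝕜 (Step 𝕜 m n) where
  norm_nonneg f := Real.iSup_nonneg fun p => by positivity
  norm_smul c f := by
    change (⨆ p : ℝ × Fin (m + 1), ((1 + |p.1| ^ 2) ^ n)⁻¹ * ‖iteratedDeriv p.2 (c • f.1) p.1‖) = _
    rw [show ‖f‖ = ⨆ p : ℝ × Fin (m + 1),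
      ((1 + |p.1| ^ 2) ^ n)⁻¹ * ‖iteratedDeriv p.2 f.1 p.1‖ from rfl,
      Real.mul_iSup_of_nonneg (norm_nonneg c)]
    congr 1
    ext p
    have hj' : ((p.2 : ℕ) : WithTop ℕ∞) ≤ m := by exact_mod_cast Nat.lt_succ_iff.1 p.2.2
    rw [iteratedDeriv_const_smul (f.2.1.of_le hj').contDiffAt, norm_smul, mul_left_comm]
  norm_triangle f g := by
    refine ciSup_le fun p => ?_
    have hj' : ((p.2 : ℕ) : WithTop ℕ∞) ≤ m := by exact_mod_cast Nat.lt_succ_iff.1 p.2.2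
    change ((1 + |p.1| ^ 2) ^ n)⁻¹ * ‖iteratedDeriv p.2 (f.1 + g.1) p.1‖ ≤ _
    rw [iteratedDeriv_add (f.2.1.of_le hj').contDiffAt (g.2.1.of_le hj').contDiffAt]
    have h3 : 0 ≤ ((1 + |p.1| ^ 2) ^ n)⁻¹ := by positivity
    have h4 := mul_le_mul_of_nonneg_left
      (norm_add_le (iteratedDeriv p.2 f.1 p.1) (iteratedDeriv p.2 g.1 p.1)) h3
    rw [mul_add] at h4
    linarith [f.le_norm p, g.le_norm p]
  norm_eq_zero_iff f := by
    constructor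
    · intro h
      apply Subtype.ext
      funext x
      have h1 := f.le_norm (x, 0)
      rw [h] at h1
      have h2 : 0 < ((1 + |x| ^ 2) ^ n)⁻¹ := by positivity
      have h3 : ‖f.1 x‖ ≤ 0 := by
        by_contra hc
        push Not at hc
        have h4 := mul_pos h2 hc
        simp only [Fin.val_zero, iteratedDeriv_zero] at h1
        linarith
      exact norm_le_zero_iff.1 h3
    · rintro rfl
      change (⨆ p : ℝ × Fin (m + 1),
        ((1 + |p.1| ^ 2) ^ n)⁻¹ * ‖iteratedDeriv p.2 (0 : ℝ → 𝕜) p.1‖) = 0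
      simp [iteratedDeriv_eq_iteratedFDeriv]

instance (𝕜 : Type*) [RCLike 𝕜] (m n : ℕ) : NormedAddCommGroup (Step 𝕜 m n) :=
  NormedAddCommGroup.ofCore (Step.core 𝕜 m n)

theorem stepSubmodule_mono (𝕜 : Type*) [RCLike 𝕜] (m : ℕ) : Monotone (stepSubmodule 𝕜 m) := by
  rintro n n' hn f ⟨hf, C, hC⟩
  refine ⟨hf, C, fun x j hj => le_trans ?_ (hC x j hj)⟩
  have h1 : (1 : ℝ) ≤ 1 + |x| ^ 2 := by nlinarith [sq_nonneg |x|]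
  gcongr

/-- The vector space `𝒪ᵐ(ℝ) = ⋃ₙ 𝒪ₙᵐ(ℝ)`. (Here and below, indices start at `0` instead of `1`,
which changes neither the spaces `𝒪ᵐ(ℝ)` and `𝒪_M(ℝ)` nor their topologies.) -/
def limSubmodule (𝕜 : Type*) [RCLike 𝕜] (m : ℕ) : Submodule 𝕜 (ℝ → 𝕜) where
  carrier := {f | ∃ n, f ∈ stepSubmodule 𝕜 m n}
  zero_mem' := ⟨0, zero_mem _⟩
  add_mem' := by
    rintro f g ⟨n, hf⟩ ⟨n', hg⟩
    exact ⟨max n n', add_mem (stepSubmodule_mono 𝕜 m (le_max_left n n') hf)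
      (stepSubmodule_mono 𝕜 m (le_max_right n n') hg)⟩
  smul_mem' := by
    rintro c f ⟨n, hf⟩
    exact ⟨n, Submodule.smul_mem _ c hf⟩

/-- `𝒪ᵐ(ℝ)` as a type, carrying the topology of the inductive limit below. -/
def Lim (𝕜 : Type*) [RCLike 𝕜] (m : ℕ) : Type _ := limSubmodule 𝕜 m

instance (𝕜 : Type*) [RCLike 𝕜] (m : ℕ) : AddCommGroup (Lim 𝕜 m) :=
  inferInstanceAs (AddCommGroup (limSubmodule 𝕜 m))

instance (𝕜 : Type*) [RCLike 𝕜] (m : ℕ) : Module 𝕜 (Lim 𝕜 m) :=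
  inferInstanceAs (Module 𝕜 (limSubmodule 𝕜 m))

instance (priority := 900) (𝕜 : Type*) [RCLike 𝕜] (m : ℕ) : Module ℝ (Lim 𝕜 m) :=
  inferInstanceAs (Module ℝ (limSubmodule 𝕜 m))

/-- The inclusion `𝒪ₙᵐ(ℝ) → 𝒪ᵐ(ℝ)`. -/
def Step.toLim {𝕜 : Type*} [RCLike 𝕜] {m n : ℕ} (f : Step 𝕜 m n) : Lim 𝕜 m := ⟨f.1, n, f.2⟩

/-- The (LB)-topology of `𝒪ᵐ(ℝ) = indₙ 𝒪ₙᵐ(ℝ)`: the finest locally convex vector space topology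
for which all inclusions of the normed spaces `𝒪ₙᵐ(ℝ)` are continuous. -/
instance (𝕜 : Type*) [RCLike 𝕜] (m : ℕ) : TopologicalSpace (Lim 𝕜 m) :=
  sInf {t | (∀ n, Continuous[_, t] (Step.toLim : Step 𝕜 m n → Lim 𝕜 m)) ∧
    @IsTopologicalAddGroup (Lim 𝕜 m) t _ ∧
    @ContinuousSMul 𝕜 (Lim 𝕜 m) _ _ t ∧
    @LocallyConvexSpace ℝ (Lim 𝕜 m) _ _ _ _ t}

/-- The vector space `𝒪_M(ℝ) = ⋂ₘ ⋃ₙ 𝒪ₙᵐ(ℝ)`. -/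
def slowlyIncreasing (𝕜 : Type*) [RCLike 𝕜] : Submodule 𝕜 (ℝ → 𝕜) := ⨅ m, limSubmodule 𝕜 m

/-- `𝒪_M(ℝ)` as a type, carrying the topology of the projective limit below. -/
def OM (𝕜 : Type*) [RCLike 𝕜] : Type _ := slowlyIncreasing 𝕜

instance (𝕜 : Type*) [RCLike 𝕜] : AddCommGroup (OM 𝕜) :=
  inferInstanceAs (AddCommGroup (slowlyIncreasing 𝕜))

instance (𝕜 : Type*) [RCLike 𝕜] : Module 𝕜 (OM 𝕜) :=
  inferInstanceAs (Module 𝕜 (slowlyIncreasing 𝕜))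

/-- The inclusion `𝒪_M(ℝ) → 𝒪ᵐ(ℝ)`. -/
def OM.toLim {𝕜 : Type*} [RCLike 𝕜] (m : ℕ) (f : OM 𝕜) : Lim 𝕜 m :=
  ⟨f.1, (Submodule.mem_iInf _).1 f.2 m⟩

/-- The topology of `𝒪_M(ℝ) = projₘ 𝒪ᵐ(ℝ)`: the coarsest topology for which all inclusions
`𝒪_M(ℝ) → 𝒪ᵐ(ℝ)` are continuous. -/
instance (𝕜 : Type*) [RCLike 𝕜] : TopologicalSpace (OM 𝕜) :=
  ⨅ m, TopologicalSpace.induced (OM.toLim m) inferInstance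

theorem mem_slowlyIncreasing_iff {𝕜 : Type*} [RCLike 𝕜] {f : ℝ → 𝕜} :
    f ∈ slowlyIncreasing 𝕜 ↔ f.HasTemperateGrowth := by
  constructor
  · intro hf
    have hf' : ∀ m, ∃ n, f ∈ stepSubmodule 𝕜 m n := (Submodule.mem_iInf _).1 hf
    refine ⟨contDiff_infty.2 fun m => (hf' m).choose_spec.1, fun m => ?_⟩
    obtain ⟨n, -, C, hC⟩ := hf' m
    refine ⟨2 * n, |C|, fun x => ?_⟩
    have h1 := hC x m le_rfl
    have h2 : 0 < (1 + |x| ^ 2) ^ n := by positivity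
    rw [inv_mul_le_iff₀ h2] at h1
    rw [norm_iteratedFDeriv_eq_norm_iteratedDeriv]
    have h3 : (1 + |x| ^ 2) ^ n ≤ (1 + ‖x‖) ^ (2 * n) := by
      rw [pow_mul, Real.norm_eq_abs]
      gcongr
      nlinarith [abs_nonneg x]
    calc _ ≤ (1 + |x| ^ 2) ^ n * C := h1
      _ ≤ (1 + |x| ^ 2) ^ n * |C| := by gcongr; exact le_abs_self C
      _ ≤ (1 + ‖x‖) ^ (2 * n) * |C| := by gcongr
      _ = _ := mul_comm _ _
  · intro hf
    refine (Submodule.mem_iInf _).2 fun m => ?_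
    obtain ⟨k, C, hC, h⟩ := hf.norm_iteratedFDeriv_le_uniform m
    refine ⟨k, hf.1.of_le (by exact_mod_cast le_top), C * 2 ^ k, fun x j hj => ?_⟩
    have h1 := h j hj x
    rw [norm_iteratedFDeriv_eq_norm_iteratedDeriv, Real.norm_eq_abs] at h1
    have h2 : 0 < (1 + |x| ^ 2) ^ k := by positivity
    rw [inv_mul_le_iff₀ h2]
    have h3 : (1 + |x|) ^ k ≤ (2 * (1 + |x| ^ 2)) ^ k := by
      gcongr
      nlinarith [sq_nonneg (|x| - 1)]
    calc _ ≤ C * (1 + |x|) ^ k := h1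
      _ ≤ C * (2 * (1 + |x| ^ 2)) ^ k := by gcongr
      _ = _ := by rw [mul_pow]; ring

/-- The composition operator `C_ψ : 𝒪_M(ℝ) → 𝒪_M(ℝ)`, `f ↦ f ∘ ψ`. -/
def compOp (𝕜 : Type*) [RCLike 𝕜] (ψ : ℝ → ℝ) (hψ : ψ ∈ slowlyIncreasing ℝ) :
    OM 𝕜 →ₗ[𝕜] OM 𝕜 where
  toFun f := ⟨f.1 ∘ ψ, mem_slowlyIncreasing_iff.2
    ((mem_slowlyIncreasing_iff.1 f.2).comp (mem_slowlyIncreasing_iff.1 hψ))⟩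
  map_add' _ _ := rfl
  map_smul' _ _ := rfl

/-- A self-map `T` of a topological space is mixing if for all non-empty open `U`, `V` there is
`N` with `Tⁿ(U) ∩ V ≠ ∅` for all `n ≥ N`. -/
def IsMixing {X : Type*} [TopologicalSpace X] (T : X → X) : Prop :=
  ∀ U V : Set X, IsOpen U → IsOpen V → U.Nonempty → V.Nonempty →
    ∃ N : ℕ, ∀ n ≥ N, (T^[n] '' U ∩ V).Nonempty

/-- The iterates `ψₙ`, `n ∈ ℤ`: `ψₙ` is the `n`-fold composition for `n ≥ 0`, and `ψ₋ₙ` is the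
inverse function of `ψₙ` (this is used for bijective `ψ` only). -/
def zIter (ψ : ℝ → ℝ) : ℤ → ℝ → ℝ
  | Int.ofNat n => ψ^[n]
  | Int.negSucc n => Function.invFun ψ^[n + 1]

/-- `sup_{x ∈ A} |v(x) φ⁽ᵏ⁾(x)|`, with value in `[0, ∞]`. -/
def weightedSup {𝕜 : Type*} [RCLike 𝕜] (v : 𝓢(ℝ, 𝕜)) (φ : ℝ → ℝ) (k : ℕ) (A : Set ℝ) : ENNReal :=
  ⨆ x ∈ A, ‖v x * ((iteratedDeriv k φ x : ℝ) : 𝕜)‖ₑ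

/-- `lim_{n → ∞} sup { |v(x) (ψₙ)⁽ᵏ⁾(x)| : x ∈ ψ₋ₙ([min{a, ψ(a)}, max{a, ψ(a)}]) } = 0`. -/
def ForwardDecay {𝕜 : Type*} [RCLike 𝕜] (ψ : ℝ → ℝ) (a : ℝ) (k : ℕ) (v : 𝓢(ℝ, 𝕜)) : Prop :=
  Filter.Tendsto (fun n : ℕ => weightedSup v (zIter ψ n) k
    (zIter ψ (-n) '' Set.Icc (min a (ψ a)) (max a (ψ a)))) Filter.atTop (𝓝 0)

/-- `lim_{n → ∞} sup { |v(x) (ψ₋ₙ)⁽ᵏ⁾(x)| : x ∈ ψₙ([min{a, ψ(a)}, max{a, ψ(a)}]) } = 0`. -/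
def BackwardDecay {𝕜 : Type*} [RCLike 𝕜] (ψ : ℝ → ℝ) (a : ℝ) (k : ℕ) (v : 𝓢(ℝ, 𝕜)) : Prop :=
  Filter.Tendsto (fun n : ℕ => weightedSup v (zIter ψ (-n)) k
    (zIter ψ n '' Set.Icc (min a (ψ a)) (max a (ψ a)))) Filter.atTop (𝓝 0)

end SlowlyIncreasing

end

open SlowlyIncreasing

noncomputable section

namespace SlowlyIncreasing

open Filter

variable {𝕜 : Type*} [RCLike 𝕜]

/-! The decay conditions are polynomial bounds in disguise. Without fixed points, the preimages of a
bounded interval under `ψₙ` leave every bounded set. A family on such escaping sets that each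
Schwartz weight keeps bounded is dominated by a single polynomial (`exists_polynomial_bound`):
otherwise small bumps at the bad points sum to a Schwartz weight that detects the growth. Hence the
decay conditions amount to `PolyBound` for the iterates of `ψ` and of its inverse `θ`
(`tendsto_weightedSup_iff_polyBound`).

Bounds imply mixing by a Kitai-type argument: for compactly supported `u`, `w`, which are dense,
both `u ∘ ψₙ` and `w ∘ ψ₋ₙ` tend to zero, so `u + w ∘ ψ₋ₙ` is close to `u` and its image `u ∘ ψₙ +
w` is close to `w`. One interval `I_a` suffices because it is a fundamental domain: a compact set
reaches it in boundedly many steps (`IsFlow.exists_cover`).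

Conversely, rapidly decreasing weights give continuous seminorms on `𝒪_M(ℝ)`. Mixing therefore
yields `f` close to the identity on a given interval with `f ∘ ψₙ` small. In `ψₙ = f ∘ ψₙ - (f - id)
∘ ψₙ` the last term contributes at most half of the derivative being estimated, plus lower-order
terms, so induction on the order gives the bounds (`polyBound_of_approx`). Applied to `f ∘ ψₙ` in
place of `f`, the same argument treats `θ`. -/

/-! ### Weighted seminorms and null sequences in `𝒪_M(ℝ)`. -/

instance (m : ℕ) : IsTopologicalAddGroup (Lim 𝕜 m) :=
  topologicalAddGroup_sInf fun _ ht => ht.2.1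

theorem Step.continuous_toLim (m n : ℕ) : Continuous (Step.toLim : Step 𝕜 m n → Lim 𝕜 m) :=
  continuous_sInf_rng.2 fun _ ht => ht.1 n

/-- The inclusion `𝒪_M(ℝ) → 𝒪ᵐ(ℝ)` as an additive homomorphism. -/
def OM.toLimHom (m : ℕ) : OM 𝕜 →+ Lim 𝕜 m where
  toFun := OM.toLim m
  map_zero' := rfl
  map_add' _ _ := rfl

instance : IsTopologicalAddGroup (OM 𝕜) :=
  topologicalAddGroup_iInf fun m => topologicalAddGroup_induced (OM.toLimHom (𝕜 := 𝕜) m)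

theorem OM.continuous_toLim (m : ℕ) : Continuous (OM.toLim m : OM 𝕜 → Lim 𝕜 m) :=
  continuous_iff_le_induced.2 (iInf_le _ m)

theorem OM.contDiff (f : OM 𝕜) : ContDiff ℝ ∞ f.1 :=
  (mem_slowlyIncreasing_iff.1 f.2).1

theorem OM.tendsto_nhds_iff {F : ℕ → OM 𝕜} {f : OM 𝕜} :
    Tendsto F atTop (𝓝 f) ↔ ∀ m, Tendsto (fun n => (F n).toLim m) atTop (𝓝 (f.toLim m)) := by
  rw [nhds_iInf, tendsto_iInf]
  refine forall_congr' fun m => ?_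
  rw [nhds_induced, tendsto_comap_iff]
  rfl

/-- Weights that decrease faster than the inverse of any polynomial. -/
def IsRapid (w : ℝ → ℝ) : Prop :=
  (∀ x, 0 ≤ w x) ∧ ∀ N : ℕ, ∃ C : ℝ, ∀ x, w x * (1 + |x| ^ 2) ^ N ≤ C

theorem IsRapid.exists_bound {w : ℝ → ℝ} (hw : IsRapid w) (m n : ℕ) :
    ∃ C : ℝ, 0 ≤ C ∧ ∀ g : Step 𝕜 m n, ∀ p : ℝ × Fin (m + 1),
      w p.1 * ‖iteratedDeriv p.2 g.1 p.1‖ ≤ C * ‖g‖ := by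
  obtain ⟨C, hC⟩ := hw.2 n
  have hC0 : 0 ≤ C := le_trans (mul_nonneg (hw.1 0) (by positivity)) (hC 0)
  refine ⟨C, hC0, fun g p => ?_⟩
  have h1 := g.le_norm p
  have h2 : (0 : ℝ) < (1 + |p.1| ^ 2) ^ n := by positivity
  calc w p.1 * ‖iteratedDeriv p.2 g.1 p.1‖
      = (w p.1 * (1 + |p.1| ^ 2) ^ n) *
        (((1 + |p.1| ^ 2) ^ n)⁻¹ * ‖iteratedDeriv p.2 g.1 p.1‖) := by
        field_simp
    _ ≤ C * ‖g‖ := by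
        gcongr
        exact hC p.1

theorem IsRapid.bddAbove {w : ℝ → ℝ} (hw : IsRapid w) {m : ℕ} (f : Lim 𝕜 m) :
    BddAbove (Set.range fun p : ℝ × Fin (m + 1) => w p.1 * ‖iteratedDeriv p.2 f.1 p.1‖) := by
  obtain ⟨f, n, hf⟩ := f
  let g : Step 𝕜 m n := ⟨f, hf⟩
  obtain ⟨C, -, hC⟩ := hw.exists_bound (𝕜 := 𝕜) m n
  refine ⟨C * ‖g‖, ?_⟩
  rintro _ ⟨p, rfl⟩
  exact hC g p

/-- The seminorm `f ↦ sup_{x, j ≤ m} w(x) |f⁽ʲ⁾(x)|` on `𝒪ᵐ(ℝ)`. -/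
def weightSeminorm (𝕜 : Type*) [RCLike 𝕜] {w : ℝ → ℝ} (hw : IsRapid w) (m : ℕ) :
    Seminorm 𝕜 (Lim 𝕜 m) :=
  Seminorm.of (fun f => ⨆ p : ℝ × Fin (m + 1), w p.1 * ‖iteratedDeriv p.2 f.1 p.1‖)
    (by
      intro f g
      refine ciSup_le fun p => ?_
      have hj' : ((p.2 : ℕ) : WithTop ℕ∞) ≤ m := by exact_mod_cast Nat.lt_succ_iff.1 p.2.2
      obtain ⟨nf, hf⟩ := f.2
      obtain ⟨ng, hg⟩ := g.2
      change w p.1 * ‖iteratedDeriv p.2 (f.1 + g.1) p.1‖ ≤ _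
      rw [iteratedDeriv_add (hf.1.of_le hj').contDiffAt (hg.1.of_le hj').contDiffAt]
      have h4 := mul_le_mul_of_nonneg_left
        (norm_add_le (iteratedDeriv p.2 f.1 p.1) (iteratedDeriv p.2 g.1 p.1)) (hw.1 p.1)
      rw [mul_add] at h4
      exact h4.trans (add_le_add (le_ciSup (hw.bddAbove f) p) (le_ciSup (hw.bddAbove g) p)))
    (by
      intro c f
      rw [Real.mul_iSup_of_nonneg (norm_nonneg c)]
      congr 1
      ext p
      have hj' : ((p.2 : ℕ) : WithTop ℕ∞) ≤ m := by exact_mod_cast Nat.lt_succ_iff.1 p.2.2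
      obtain ⟨nf, hf⟩ := f.2
      change w p.1 * ‖iteratedDeriv p.2 (c • f.1) p.1‖ = _
      rw [iteratedDeriv_const_smul (hf.1.of_le hj').contDiffAt, norm_smul, mul_left_comm])

theorem le_weightSeminorm {w : ℝ → ℝ} (hw : IsRapid w) {m : ℕ} (f : Lim 𝕜 m) {j : ℕ}
    (hj : j ≤ m) (x : ℝ) : w x * ‖iteratedDeriv j f.1 x‖ ≤ weightSeminorm 𝕜 hw m f :=
  le_ciSup (hw.bddAbove f) (x, ⟨j, Nat.lt_succ_of_le hj⟩)

instance (m : ℕ) : IsScalarTower ℝ 𝕜 (Lim 𝕜 m) :=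
  inferInstanceAs (IsScalarTower ℝ 𝕜 (limSubmodule 𝕜 m))

/-- The topology of this one seminorm is locally convex and makes all step inclusions continuous, so
it competes in the infimum defining the inductive limit topology, which is therefore finer. -/
theorem isOpen_ball_weightSeminorm {w : ℝ → ℝ} (hw : IsRapid w) {m : ℕ} (f : Lim 𝕜 m)
    (ε : ℝ) : IsOpen ((weightSeminorm 𝕜 hw m).ball f ε) := by
  let p : SeminormFamily 𝕜 (Lim 𝕜 m) Unit := fun _ => weightSeminorm 𝕜 hw m
  let t : TopologicalSpace (Lim 𝕜 m) := p.moduleFilterBasis.topology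
  have ht : @WithSeminorms 𝕜 (Lim 𝕜 m) Unit _ _ _ p t := @WithSeminorms.mk _ _ _ _ _ _ p t rfl
  have hmem : t ∈ {t | (∀ n, Continuous[_, t] (Step.toLim : Step 𝕜 m n → Lim 𝕜 m)) ∧
      @IsTopologicalAddGroup (Lim 𝕜 m) t _ ∧
      @ContinuousSMul 𝕜 (Lim 𝕜 m) _ _ t ∧
      @LocallyConvexSpace ℝ (Lim 𝕜 m) _ _ _ _ t} := by
    refine ⟨fun n => ?_, @WithSeminorms.topologicalAddGroup _ _ _ _ _ _ t _ ht,
      @WithSeminorms.continuousSMul _ _ _ _ _ _ t _ ht,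
      @WithSeminorms.toLocallyConvexSpace _ _ _ _ _ _ _ _ _ t _ ht⟩
    refine (@continuous_iff_continuousAt _ _ _ t _).2 fun g => ?_
    refine (@WithSeminorms.tendsto_nhds _ _ _ _ _ _ _ t p ht _ _ _).2 fun _ ε hε => ?_
    obtain ⟨C, hC0, hC⟩ := hw.exists_bound (𝕜 := 𝕜) m n
    have hδ : 0 < ε / (C + 1) := by positivity
    filter_upwards [Metric.ball_mem_nhds g hδ] with h hh
    rw [Metric.mem_ball, dist_eq_norm, lt_div_iff₀ (by positivity)] at hh
    refine lt_of_le_of_lt (ciSup_le fun q => hC (h - g) q) ?_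
    nlinarith [norm_nonneg (h - g)]
  refine sInf_le hmem _ ?_
  refine (@WithSeminorms.isOpen_iff_mem_balls _ _ _ _ _ _ t p ht _).2 fun x hx => ?_
  rw [Seminorm.mem_ball] at hx
  refine ⟨{()}, ε - weightSeminorm 𝕜 hw m (x - f), sub_pos.2 hx, fun y hy => ?_⟩
  rw [Finset.sup_singleton, Seminorm.mem_ball] at hy
  rw [Seminorm.mem_ball]
  have h1 := map_add_le_add (weightSeminorm 𝕜 hw m) (y - x) (x - f)
  rw [sub_add_sub_cancel] at h1
  exact h1.trans_lt (lt_sub_iff_add_lt.1 hy)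

/-- Neighbourhoods in `𝒪_M(ℝ)` given by rapidly decreasing weights. -/
theorem OM.exists_isOpen {w : ℝ → ℝ} (hw : IsRapid w) (m : ℕ) (f : OM 𝕜) {ε : ℝ} (hε : 0 < ε) :
    ∃ U : Set (OM 𝕜), IsOpen U ∧ f ∈ U ∧
      ∀ g ∈ U, ∀ j ≤ m, ∀ x, w x * ‖iteratedDeriv j (g.1 - f.1) x‖ < ε := by
  refine ⟨OM.toLim m ⁻¹' (weightSeminorm 𝕜 hw m).ball (f.toLim m) ε,
    (isOpen_ball_weightSeminorm hw _ ε).preimage (OM.continuous_toLim m), ?_, ?_⟩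
  · simpa using hε
  · intro g hg j hj x
    rw [Set.mem_preimage, Seminorm.mem_ball] at hg
    exact (le_weightSeminorm hw _ hj x).trans_lt hg

theorem iteratedDeriv_eq_zero_of_eqOn_zero {F : Type*} [NormedAddCommGroup F] [NormedSpace ℝ F]
    {f : ℝ → F} {s : Set ℝ} (hs : IsOpen s) (h : ∀ x ∈ s, f x = 0) (j : ℕ) {x : ℝ} (hx : x ∈ s) :
    iteratedDeriv j f x = 0 := by
  have h1 : f =ᶠ[𝓝 x] 0 := by
    filter_upwards [hs.mem_nhds hx] with y hy using h y hy
  rw [h1.iteratedDeriv_eq]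
  simp [iteratedDeriv_eq_iteratedFDeriv]

/-- A sequence in `𝒪_M(ℝ)` that is bounded in a step of each `𝒪ᵐ(ℝ)` and vanishes on larger and
larger intervals tends to zero. -/
theorem OM.tendsto_zero {F : ℕ → OM 𝕜}
    (hb : ∀ m : ℕ, ∃ N : ℕ, ∃ C : ℝ, ∀ᶠ n in atTop, ∀ j ≤ m, ∀ x,
      ‖iteratedDeriv j (F n).1 x‖ ≤ C * (1 + |x| ^ 2) ^ N)
    (hv : ∀ R : ℝ, ∀ᶠ n in atTop, ∀ x, |x| < R → (F n).1 x = 0) :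
    Tendsto F atTop (𝓝 0) := by
  refine OM.tendsto_nhds_iff.2 fun m => ?_
  obtain ⟨N, C, hC⟩ := hb m
  -- Passing from step `N` to step `N + 1` gains a factor `(1 + |x|²)⁻¹`, which is small exactly
  -- where `F n` is not yet known to vanish.
  have key : ∀ ε > 0, ∀ᶠ n in atTop, ∀ j ≤ m, ∀ x,
      ((1 + |x| ^ 2) ^ (N + 1))⁻¹ * ‖iteratedDeriv j (F n).1 x‖ ≤ ε := by
    intro ε hε
    filter_upwards [hC, hv (|C| / ε + 1)] with n h1 h2 j hj x
    rw [inv_mul_le_iff₀ (by positivity)]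
    by_cases hx : |x| < |C| / ε + 1
    · rw [iteratedDeriv_eq_zero_of_eqOn_zero (s := {x | |x| < |C| / ε + 1})
        (isOpen_lt continuous_abs continuous_const) h2 j hx, norm_zero]
      positivity
    · refine (h1 j hj x).trans ?_
      push Not at hx
      have h0 : 0 ≤ |C| / ε := by positivity
      have h3 : |C| / ε ≤ 1 + |x| ^ 2 := by nlinarith
      rw [div_le_iff₀ hε] at h3
      calc C * (1 + |x| ^ 2) ^ N ≤ ((1 + |x| ^ 2) * ε) * (1 + |x| ^ 2) ^ N := by
            gcongr
            exact (le_abs_self C).trans h3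
        _ = _ := by ring
  classical
  let G : ℕ → Step 𝕜 m (N + 1) := fun n =>
    if h : (F n).1 ∈ stepSubmodule 𝕜 m (N + 1) then ⟨(F n).1, h⟩ else 0
  have hG : ∀ᶠ n in atTop, (G n).toLim = (F n).toLim m := by
    filter_upwards [key 1 one_pos] with n hn
    have h : (F n).1 ∈ stepSubmodule 𝕜 m (N + 1) :=
      ⟨(F n).contDiff.of_le (by exact_mod_cast le_top), 1, fun x j hj => hn j hj x⟩
    have hGn : G n = ⟨(F n).1, h⟩ := dif_pos h
    rw [hGn]
    rfl
  have hG0 : Tendsto G atTop (𝓝 0) := by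
    rw [Metric.tendsto_nhds]
    intro ε hε
    filter_upwards [key (ε / 2) (by positivity), hG] with n hn hn'
    rw [dist_zero_right]
    refine lt_of_le_of_lt (ciSup_le fun p => ?_) (half_lt_self hε)
    have : (G n).1 = (F n).1 := congrArg Subtype.val hn'
    rw [this]
    exact hn p.2 (Nat.lt_succ_iff.1 p.2.2) p.1
  have := ((Step.continuous_toLim (𝕜 := 𝕜) m (N + 1)).tendsto 0).comp hG0
  exact this.congr' hG

/-! ### Schwartz weights and polynomial bounds. -/

theorem isRapid_norm (v : 𝓢(ℝ, 𝕜)) : IsRapid fun x => ‖v x‖ := by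
  refine ⟨fun x => norm_nonneg _, fun N => ?_⟩
  obtain ⟨C, hC0, hC⟩ := v.decay 0 0
  obtain ⟨D, hD0, hD⟩ := v.decay (2 * N) 0
  simp only [norm_iteratedFDeriv_zero, Real.norm_eq_abs, pow_zero, one_mul] at hC hD
  refine ⟨2 ^ N * (C + D), fun x => ?_⟩
  have h1 : (1 + |x| ^ 2) ^ N ≤ 2 ^ N * (1 + |x| ^ (2 * N)) := by
    have := add_pow_le (zero_le_one' ℝ) (sq_nonneg |x|) N
    rw [one_pow, ← pow_mul] at this
    refine this.trans ?_
    gcongr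
    · norm_num
    · omega
  calc ‖v x‖ * (1 + |x| ^ 2) ^ N ≤ ‖v x‖ * (2 ^ N * (1 + |x| ^ (2 * N))) := by gcongr
    _ = 2 ^ N * (‖v x‖ + |x| ^ (2 * N) * ‖v x‖) := by ring
    _ ≤ 2 ^ N * (C + D) := by
        gcongr
        · exact hC x
        · exact hD x

/-- Weights need not be continuous; this one makes uniform approximation of derivatives on a compact
interval an instance of the weighted seminorms. -/
theorem isRapid_indicator (R : ℝ) : IsRapid (Set.indicator (Set.Icc (-R) R) 1) := by
  refine ⟨fun x => Set.indicator_nonneg (fun _ _ => zero_le_one) x, fun N =>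
    ⟨(1 + |R| ^ 2) ^ N, fun x => ?_⟩⟩
  by_cases hx : x ∈ Set.Icc (-R) R
  · rw [Set.indicator_of_mem hx, Pi.one_apply, one_mul]
    have : |x| ≤ |R| := (abs_le.2 hx).trans (le_abs_self R)
    gcongr
  · rw [Set.indicator_of_notMem hx, zero_mul]
    positivity

/-- A Schwartz function that is bounded below at prescribed points. -/
theorem exists_schwartz_ge (y c : ℕ → ℝ) (hc : ∀ i, 0 ≤ c i)
    (hs : ∀ k : ℕ, Summable fun i => c i * (1 + |y i|) ^ k) :
    ∃ v : 𝓢(ℝ, 𝕜), ∀ i, c i ≤ ‖v (y i)‖ := by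
  let b : ContDiffBump (0 : ℝ) := ⟨1, 2, one_pos, one_lt_two⟩
  let φ : 𝓢(ℝ, ℝ) := b.hasCompactSupport.toSchwartzMap b.contDiff
  have hφ : ∀ x, φ x = b x := fun x => rfl
  let f : ℕ → ℝ → ℝ := fun i x => c i * φ (x - y i)
  have hφs : ∀ i, ContDiff ℝ ∞ fun x => φ (x - y i) := fun i =>
    φ.smooth'.comp (contDiff_id.sub contDiff_const)
  -- The desired function is `∑ f i`. The bumps may overlap: being nonnegative, they cannot cancel,
  -- and the `i`-th one alone contributes `c i` at `y i`.
  have hfs : ∀ i, ContDiff ℝ ∞ (f i) := fun i => contDiff_const.mul (hφs i)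
  have hfd : ∀ i k x, ‖iteratedFDeriv ℝ k (f i) x‖ = c i * ‖iteratedFDeriv ℝ k φ (x - y i)‖ := by
    intro i k x
    have : f i = c i • fun x => φ (x - y i) := rfl
    rw [this, iteratedFDeriv_const_smul_apply
      ((hφs i).of_le (by exact_mod_cast le_top)).contDiffAt, norm_smul, Real.norm_of_nonneg (hc i),
      iteratedFDeriv_comp_sub]
  choose B hB0 hB using fun k n => φ.decay k n
  have hdec : ∀ k n i x, ‖x‖ ^ k * ‖iteratedFDeriv ℝ n (f i) x‖ ≤
      2 ^ k * (B k n + B 0 n) * (c i * (1 + |y i|) ^ k) := by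
    intro k n i x
    rw [hfd]
    have h1 : ‖x‖ ^ k ≤ 2 ^ k * (‖x - y i‖ ^ k + 1) * (1 + |y i|) ^ k := by
      have h2 : ‖x‖ ≤ (‖x - y i‖ + 1) * (1 + |y i|) := by
        have := norm_add_le (x - y i) (y i)
        rw [sub_add_cancel, Real.norm_eq_abs (y i)] at this
        nlinarith [abs_nonneg (y i), norm_nonneg (x - y i)]
      calc ‖x‖ ^ k ≤ ((‖x - y i‖ + 1) * (1 + |y i|)) ^ k := by gcongr
        _ = (‖x - y i‖ + 1) ^ k * (1 + |y i|) ^ k := mul_pow _ _ _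
        _ ≤ _ := by
          gcongr
          have := add_pow_le (norm_nonneg (x - y i)) (zero_le_one' ℝ) k
          rw [one_pow] at this
          refine this.trans ?_
          gcongr
          · norm_num
          · omega
    have h3 := hB k n (x - y i)
    have h4 := hB 0 n (x - y i)
    rw [pow_zero, one_mul] at h4
    calc ‖x‖ ^ k * (c i * ‖iteratedFDeriv ℝ n φ (x - y i)‖)
        ≤ (2 ^ k * (‖x - y i‖ ^ k + 1) * (1 + |y i|) ^ k) *
          (c i * ‖iteratedFDeriv ℝ n φ (x - y i)‖) := by
          have := hc i
          gcongr
      _ = 2 ^ k * (‖x - y i‖ ^ k * ‖iteratedFDeriv ℝ n φ (x - y i)‖ +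
          ‖iteratedFDeriv ℝ n φ (x - y i)‖) * (c i * (1 + |y i|) ^ k) := by ring
      _ ≤ _ := by
          have := hc i
          gcongr
  have hsum : ∀ k n : ℕ, Summable fun i => 2 ^ k * (B k n + B 0 n) * (c i * (1 + |y i|) ^ k) :=
    fun k n => (hs k).mul_left _
  have hbound : ∀ (k i : ℕ) (x : ℝ), (k : ℕ∞) ≤ ⊤ → ‖iteratedFDeriv ℝ k (f i) x‖ ≤
      2 ^ 0 * (B 0 k + B 0 k) * (c i * (1 + |y i|) ^ 0) := by
    intro k i x _
    simpa using hdec 0 k i x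
  let w : 𝓢(ℝ, ℝ) :=
    { toFun := fun x => ∑' i, f i x
      smooth' := contDiff_tsum hfs (fun k _ => hsum 0 k) hbound
      decay' := by
        intro k n
        refine ⟨∑' i, 2 ^ k * (B k n + B 0 n) * (c i * (1 + |y i|) ^ k), fun x => ?_⟩
        rw [iteratedFDeriv_tsum_apply hfs (fun k _ => hsum 0 k) hbound le_top]
        have h1 : Summable fun i => ‖iteratedFDeriv ℝ n (f i) x‖ :=
          Summable.of_nonneg_of_le (fun _ => norm_nonneg _) (fun i => hbound n i x le_top)
            (hsum 0 n)
        calc ‖x‖ ^ k * ‖∑' i, iteratedFDeriv ℝ n (f i) x‖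
            ≤ ‖x‖ ^ k * ∑' i, ‖iteratedFDeriv ℝ n (f i) x‖ := by
              gcongr
              exact norm_tsum_le_tsum_norm h1
          _ = ∑' i, ‖x‖ ^ k * ‖iteratedFDeriv ℝ n (f i) x‖ := tsum_mul_left.symm
          _ ≤ _ := (h1.mul_left _).tsum_le_tsum (fun i => hdec k n i x) (hsum k n) }
  refine ⟨SchwartzMap.postcompCLM (𝕜 := ℝ) RCLike.ofRealCLM w, fun i => ?_⟩
  have hw : ∀ x, SchwartzMap.postcompCLM (𝕜 := ℝ) (RCLike.ofRealCLM (K := 𝕜)) w x =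
    ((∑' i, f i x : ℝ) : 𝕜) := fun x => rfl
  rw [hw, RCLike.norm_ofReal]
  have hnn : ∀ j x, 0 ≤ f j x := fun j x => mul_nonneg (hc j) (by rw [hφ]; exact b.nonneg)
  have hsf : Summable fun j => f j (y i) := by
    refine Summable.of_nonneg_of_le (fun j => hnn j _) (fun j => ?_) (hsum 0 0)
    have := hbound 0 j (y i) le_top
    rw [norm_iteratedFDeriv_zero] at this
    exact (le_abs_self _).trans this
  refine le_trans ?_ (le_abs_self _)
  refine le_trans ?_ (hsf.le_tsum i fun j _ => hnn j _)
  have : φ (y i - y i) = 1 := by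
    rw [hφ, sub_self]
    exact b.one_of_mem_closedBall (by simp [b])
  simp only [f, this, mul_one, le_refl]

/-- A family that stays bounded under multiplication by every Schwartz function is bounded by a
single polynomial. -/
theorem exists_polynomial_bound (𝕜 : Type*) [RCLike 𝕜] {A : ℕ → Set ℝ} {P : ℕ → ℝ → ℝ}
    (hA : ∀ R : ℝ, ∀ᶠ n in atTop, ∀ x ∈ A n, R < |x|)
    (hP : ∀ n x, 0 ≤ P n x)
    (h : ∀ v : 𝓢(ℝ, 𝕜), ∃ M : ℝ, ∀ᶠ n in atTop, ∀ x ∈ A n, ‖v x‖ * P n x ≤ M) :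
    ∃ N : ℕ, ∃ C : ℝ, ∀ᶠ n in atTop, ∀ x ∈ A n, P n x ≤ C * (1 + |x| ^ 2) ^ N := by
  by_contra hcon
  push Not at hcon
  -- Escape supplies `1 < |x|`, so that `1 + |x|² ≥ 2` and the coefficients `(1 + |y i|²)⁻ⁱ` below
  -- decay geometrically even after multiplication by a fixed power of `1 + |y i|`.
  have h1 : ∀ N : ℕ, ∃ n ≥ N, ∃ x ∈ A n, 1 < |x| ∧ N * (1 + |x| ^ 2) ^ N < P n x := by
    intro N
    obtain ⟨n, ⟨x, hx, hxP⟩, hn1, hn2⟩ :=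
      ((hcon N N).and_eventually ((eventually_ge_atTop N).and (hA 1))).exists
    exact ⟨n, hn1, x, hx, hn2 x hx, hxP⟩
  choose n hn y hyA hy1 hyP using h1
  have hs : ∀ k : ℕ, Summable fun i => ((1 + |y i| ^ 2) ^ i)⁻¹ * (1 + |y i|) ^ k := by
    intro k
    rw [← summable_nat_add_iff k]
    refine Summable.of_nonneg_of_le (fun i => by positivity) (fun i => ?_)
      (summable_geometric_two.mul_left (2 ^ k))
    have hy := hy1 (i + k)
    have h2 : 1 + |y (i + k)| ≤ 2 * (1 + |y (i + k)| ^ 2) := by nlinarith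
    have h3 : (2 : ℝ) ≤ 1 + |y (i + k)| ^ 2 := by nlinarith
    rw [inv_mul_le_iff₀ (by positivity), pow_add]
    calc (1 + |y (i + k)|) ^ k ≤ (2 * (1 + |y (i + k)| ^ 2)) ^ k := by gcongr
      _ = 2 ^ i * (1 + |y (i + k)| ^ 2) ^ k * (2 ^ k * (1 / 2) ^ i) := by
          rw [mul_pow, one_div, inv_pow]; field_simp
      _ ≤ _ := by gcongr
  obtain ⟨v, hv⟩ := exists_schwartz_ge (𝕜 := 𝕜) y (fun i => ((1 + |y i| ^ 2) ^ i)⁻¹)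
    (fun i => by positivity) hs
  obtain ⟨M, hM⟩ := h v
  obtain ⟨n0, hn0⟩ := eventually_atTop.1 hM
  obtain ⟨i, hi⟩ := exists_nat_gt M
  -- At index `max i n0` the bound `M` is in force, while the weighted value exceeds the index,
  -- hence `M`.
  have h5 := hn0 (n (max i n0)) ((le_max_right i n0).trans (hn _)) _ (hyA (max i n0))
  have h6 := hv (max i n0)
  have h7 := hyP (max i n0)
  have h8 : ((1 + |y (max i n0)| ^ 2) ^ (max i n0))⁻¹ * P (n (max i n0)) (y (max i n0)) ≤ M :=
    le_trans (mul_le_mul_of_nonneg_right h6 (hP _ _)) h5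
  rw [inv_mul_le_iff₀ (by positivity)] at h8
  have h9 := h7.trans_le h8
  rw [mul_comm] at h9
  have h10 := lt_of_mul_lt_mul_left h9 (by positivity)
  have h11 : (i : ℝ) ≤ ((max i n0 : ℕ) : ℝ) := by exact_mod_cast le_max_left i n0
  linarith

/-- The derivatives of positive order of the maps `φ n` are, on the preimages of `I`, bounded by
polynomials independent of `n`. -/
def PolyBound (φ : ℕ → ℝ → ℝ) (I : Set ℝ) : Prop :=
  ∀ k : ℕ, 1 ≤ k → ∃ N : ℕ, ∃ C : ℝ, ∀ᶠ n in atTop, ∀ x, φ n x ∈ I →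
    |iteratedDeriv k (φ n) x| ≤ C * (1 + |x| ^ 2) ^ N

theorem exists_uniform_polyBound {φ : ℕ → ℝ → ℝ} {I : Set ℝ} (m : ℕ)
    (h : ∀ k : ℕ, 1 ≤ k → k ≤ m → ∃ N : ℕ, ∃ C : ℝ, ∀ᶠ n in atTop, ∀ x, φ n x ∈ I →
      |iteratedDeriv k (φ n) x| ≤ C * (1 + |x| ^ 2) ^ N) :
    ∃ N : ℕ, ∃ C : ℝ, 1 ≤ C ∧ ∀ᶠ n in atTop, ∀ k, 1 ≤ k → k ≤ m → ∀ x, φ n x ∈ I →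
      |iteratedDeriv k (φ n) x| ≤ C * (1 + |x| ^ 2) ^ N := by
  induction m with
  | zero => exact ⟨0, 1, le_rfl, .of_forall fun n k h1 h2 => by omega⟩
  | succ m ih =>
    obtain ⟨N, C, hC1, hC⟩ := ih fun k h1 h2 => h k h1 (by omega)
    obtain ⟨N', C', hC'⟩ := h (m + 1) (by omega) le_rfl
    refine ⟨max N N', max C C', hC1.trans (le_max_left _ _), ?_⟩
    filter_upwards [hC, hC'] with n h1 h2 k hk hkm x hx
    have h0 : (1 : ℝ) ≤ 1 + |x| ^ 2 := by nlinarith [sq_nonneg |x|]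
    have h00 : 0 ≤ max C C' := le_trans (by linarith) (le_max_left C C')
    rcases Nat.le_succ_iff.1 hkm with hkm | rfl
    · refine (h1 k hk hkm x hx).trans ?_
      gcongr
      · exact le_max_left _ _
      · exact le_max_left _ _
    · refine (h2 x hx).trans ?_
      gcongr
      · exact le_max_right _ _
      · exact le_max_right _ _

theorem weightedSup_le_iff {v : 𝓢(ℝ, 𝕜)} {φ : ℝ → ℝ} {k : ℕ} {A : Set ℝ} {ε : ℝ} :
    weightedSup v φ k A ≤ ENNReal.ofReal ε ↔
      ∀ x ∈ A, ENNReal.ofReal (‖v x‖ * |iteratedDeriv k φ x|) ≤ ENNReal.ofReal ε := by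
  simp only [weightedSup, iSup_le_iff]
  refine forall₂_congr fun x _ => ?_
  rw [← ofReal_norm, norm_mul, RCLike.norm_ofReal]

/-- A limit for every weight gives boundedness for every weight, hence one polynomial bound.
Conversely, `v` absorbs one power of `1 + |x|²` more than the bound needs, and that power is large
on the escaping preimages. -/
theorem tendsto_weightedSup_iff_polyBound (𝕜 : Type*) [RCLike 𝕜] {φ : ℕ → ℝ → ℝ} {I : Set ℝ}
    (hφ : ∀ R : ℝ, ∀ᶠ n in atTop, ∀ x, φ n x ∈ I → R < |x|) :
    (∀ k : ℕ, 1 ≤ k → ∀ v : 𝓢(ℝ, 𝕜),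
      Tendsto (fun n => weightedSup v (φ n) k (φ n ⁻¹' I)) atTop (𝓝 0)) ↔ PolyBound φ I := by
  constructor
  · intro h k hk
    refine exists_polynomial_bound 𝕜 (A := fun n => φ n ⁻¹' I)
      (P := fun n x => |iteratedDeriv k (φ n) x|) hφ (fun _ _ => abs_nonneg _) fun v => ⟨1, ?_⟩
    filter_upwards [(ENNReal.tendsto_nhds_zero.1 (h k hk v)) (ENNReal.ofReal 1) (by simp)]
      with n hn x hx
    exact (ENNReal.ofReal_le_ofReal_iff zero_le_one).1 (weightedSup_le_iff.1 hn x hx)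
  · intro h k hk v
    obtain ⟨N, C, hC⟩ := h k hk
    obtain ⟨D, hD⟩ := (isRapid_norm v).2 (N + 1)
    have hD0 : 0 ≤ D := le_trans (by positivity) (hD 0)
    rw [ENNReal.tendsto_nhds_zero]
    intro ε hε
    obtain ⟨δ, hδ, hδε⟩ : ∃ δ : ℝ, 0 < δ ∧ ENNReal.ofReal δ ≤ ε := by
      obtain ⟨δ, hδ, hδε⟩ := ENNReal.lt_iff_exists_nnreal_btwn.1 hε
      exact ⟨δ, by exact_mod_cast hδ, by rw [ENNReal.ofReal_coe_nnreal]; exact hδε.le⟩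
    filter_upwards [hC, hφ (|C| * D / δ + 1)] with n h1 h2
    refine le_trans (weightedSup_le_iff.2 fun x hx => ENNReal.ofReal_le_ofReal ?_) hδε
    have h3 := h2 x hx
    have h4 : 0 ≤ |C| * D / δ := by positivity
    have h5 : |C| * D / δ ≤ 1 + |x| ^ 2 := by nlinarith
    rw [div_le_iff₀ hδ] at h5
    have h6 : 0 < 1 + |x| ^ 2 := by positivity
    refine le_of_mul_le_mul_right ?_ h6
    calc ‖v x‖ * |iteratedDeriv k (φ n) x| * (1 + |x| ^ 2)
        ≤ ‖v x‖ * (|C| * (1 + |x| ^ 2) ^ N) * (1 + |x| ^ 2) := by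
          gcongr
          refine (h1 x hx).trans ?_
          gcongr
          exact le_abs_self C
      _ = |C| * (‖v x‖ * (1 + |x| ^ 2) ^ (N + 1)) := by ring
      _ ≤ |C| * D := by gcongr; exact hD x
      _ ≤ δ * (1 + |x| ^ 2) := by linarith

/-! ### Derivatives of compositions. -/

/-- If `f` is close to the identity near `φ x`, then the `k`-th derivative of `φ` at `x` is
controlled by that of `f ∘ φ` and by the derivatives of `φ` of lower order. -/
theorem abs_iteratedDeriv_le_of_comp {φ : ℝ → ℝ} (hφ : ContDiff ℝ ∞ φ) {f : ℝ → 𝕜}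
    (hf : ContDiff ℝ ∞ f) {k : ℕ} (hk : 1 ≤ k) {x B : ℝ} (hB : 1 ≤ B)
    (hBφ : ∀ i, 1 ≤ i → i < k → |iteratedDeriv i φ x| ≤ B)
    (hfx : ∀ j ≤ k, ‖iteratedDeriv j (f - ((↑) : ℝ → 𝕜)) (φ x)‖ ≤ 1 / (2 * k.factorial)) :
    |iteratedDeriv k φ x| ≤ 2 * ‖iteratedDeriv k (f ∘ φ) x‖ + B ^ k := by
  set a := |iteratedDeriv k φ x| with ha
  have ha0 : 0 ≤ a := abs_nonneg _
  have hofR : ContDiff ℝ ∞ ((↑) : ℝ → 𝕜) := (RCLike.ofRealCLM (K := 𝕜)).contDiff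
  set h : ℝ → 𝕜 := f - ((↑) : ℝ → 𝕜) with hh
  have hhs : ContDiff ℝ ∞ h := hf.sub hofR
  have hk' : ((k : ℕ) : WithTop ℕ∞) ≤ ∞ := by exact_mod_cast le_top
  have hroot : (a ^ (1 / (k : ℝ))) ^ k = a := by
    rw [one_div]
    exact Real.rpow_inv_natCast_pow ha0 (by omega)
  -- The Faà di Bruno estimate wants the `i`-th derivative of `φ` below `D ^ i`. With `D = max B
  -- (a^(1/k))` one has `D ^ k ≤ B ^ k + a`, and the factor `k! / (2 k!) = 1/2` lets `a` be absorbed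
  -- on the left.
  have h1 := norm_iteratedFDeriv_comp_le hhs hφ hk' x
    (C := 1 / (2 * k.factorial)) (D := max B (a ^ (1 / (k : ℝ))))
    (fun i hi => by rw [norm_iteratedFDeriv_eq_norm_iteratedDeriv]; exact hfx i hi)
    (fun i hi hik => by
      rw [norm_iteratedFDeriv_eq_norm_iteratedDeriv, Real.norm_eq_abs]
      rcases hik.lt_or_eq with hik | rfl
      · calc |iteratedDeriv i φ x| ≤ B := hBφ i hi hik
          _ ≤ B ^ i := le_self_pow₀ hB (by omega)
          _ ≤ _ := by gcongr; exact le_max_left _ _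
      · calc |iteratedDeriv i φ x| = (a ^ (1 / (i : ℝ))) ^ i := hroot.symm
          _ ≤ _ := by gcongr; exact le_max_right _ _)
  have h2 : max B (a ^ (1 / (k : ℝ))) ^ k ≤ B ^ k + a := by
    rcases max_choice B (a ^ (1 / (k : ℝ))) with h | h <;> rw [h]
    · linarith
    · rw [hroot]
      have : 0 ≤ B ^ k := by positivity
      linarith
  have h3 : (k.factorial : ℝ) * (1 / (2 * k.factorial)) = 1 / 2 := by
    have : (k.factorial : ℝ) ≠ 0 := by exact_mod_cast k.factorial_ne_zero
    field_simp
  rw [h3, norm_iteratedFDeriv_eq_norm_iteratedDeriv] at h1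
  have h4 : a = ‖iteratedDeriv k (fun x => (φ x : 𝕜)) x‖ := by
    have := (RCLike.ofRealLI (K := 𝕜)).norm_iteratedFDeriv_comp_left (x := x) hφ.contDiffAt hk'
    rw [norm_iteratedFDeriv_eq_norm_iteratedDeriv,
      norm_iteratedFDeriv_eq_norm_iteratedDeriv] at this
    exact this.symm
  have h5 : (fun x => (φ x : 𝕜)) = f ∘ φ - h ∘ φ := by
    ext y
    simp [hh]
  have h6 : a ≤ ‖iteratedDeriv k (f ∘ φ) x‖ + ‖iteratedDeriv k (h ∘ φ) x‖ := by
    rw [h4, h5, iteratedDeriv_sub ((hf.comp hφ).of_le hk').contDiffAt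
      ((hhs.comp hφ).of_le hk').contDiffAt]
    exact norm_sub_le _ _
  linarith

/-- Strong induction on the order: polynomial bounds for lower derivatives serve as `B` in
`abs_iteratedDeriv_le_of_comp`, and `v` tames their `k`-th power. The approximant may depend on `v`
and `n`, since `exists_polynomial_bound` restores uniformity. -/
theorem polyBound_of_approx (𝕜 : Type*) [RCLike 𝕜] {φ : ℕ → ℝ → ℝ} {I : Set ℝ}
    (hφ : ∀ n, ContDiff ℝ ∞ (φ n))
    (hesc : ∀ R : ℝ, ∀ᶠ n in atTop, ∀ x, φ n x ∈ I → R < |x|)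
    (h : ∀ (k : ℕ) (v : 𝓢(ℝ, 𝕜)) (δ : ℝ), 0 < δ → ∀ᶠ n in atTop, ∃ f : ℝ → 𝕜, ContDiff ℝ ∞ f ∧
      (∀ j ≤ k, ∀ y ∈ I, ‖iteratedDeriv j (f - ((↑) : ℝ → 𝕜)) y‖ ≤ δ) ∧
      ∀ j ≤ k, ∀ x, ‖v x‖ * ‖iteratedDeriv j (f ∘ φ n) x‖ ≤ 1) :
    PolyBound φ I := by
  intro k
  induction k using Nat.strong_induction_on with
  | _ k ih =>
  intro hk
  obtain ⟨N, C, hC1, hC⟩ := exists_uniform_polyBound (φ := φ) (I := I) (k - 1)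
    fun i hi hik => ih i (by omega) hi
  refine exists_polynomial_bound 𝕜 (A := fun n => φ n ⁻¹' I)
    (P := fun n x => |iteratedDeriv k (φ n) x|) hesc (fun _ _ => abs_nonneg _) fun v => ?_
  obtain ⟨D, hD⟩ := (isRapid_norm v).2 (N * k)
  refine ⟨2 + C ^ k * D, ?_⟩
  filter_upwards [hC, h k v (1 / (2 * k.factorial)) (by positivity)] with n h1 ⟨f, hf, hfI, hfv⟩ x hx
  have h0 : (1 : ℝ) ≤ 1 + |x| ^ 2 := by nlinarith [sq_nonneg |x|]
  have h2 := abs_iteratedDeriv_le_of_comp (hφ n) hf hk (x := x) (B := C * (1 + |x| ^ 2) ^ N)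
    (one_le_mul_of_one_le_of_one_le hC1 (one_le_pow₀ h0))
    (fun i hi hik => h1 i hi (by omega) x hx) (fun j hj => hfI j hj _ hx)
  calc ‖v x‖ * |iteratedDeriv k (φ n) x|
      ≤ ‖v x‖ * (2 * ‖iteratedDeriv k (f ∘ φ n) x‖ + (C * (1 + |x| ^ 2) ^ N) ^ k) := by gcongr
    _ = 2 * (‖v x‖ * ‖iteratedDeriv k (f ∘ φ n) x‖) +
        C ^ k * (‖v x‖ * (1 + |x| ^ 2) ^ (N * k)) := by rw [mul_pow, ← pow_mul]; ring
    _ ≤ 2 * 1 + C ^ k * D := by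
        gcongr
        · exact hfv k le_rfl x
        · exact hD x
    _ = _ := by ring

/-- The `k`-th derivative of a composition, with a common bound for the inner derivatives. -/
theorem norm_iteratedDeriv_comp_le {φ : ℝ → ℝ} (hφ : ContDiff ℝ ∞ φ) {f : ℝ → 𝕜}
    (hf : ContDiff ℝ ∞ f) {k : ℕ} {x B C : ℝ} (hB : 1 ≤ B)
    (hBφ : ∀ i, 1 ≤ i → i ≤ k → |iteratedDeriv i φ x| ≤ B)
    (hfx : ∀ j ≤ k, ‖iteratedDeriv j f (φ x)‖ ≤ C) :
    ‖iteratedDeriv k (f ∘ φ) x‖ ≤ k.factorial * C * B ^ k := by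
  rw [← norm_iteratedFDeriv_eq_norm_iteratedDeriv]
  refine norm_iteratedFDeriv_comp_le hf hφ (by exact_mod_cast le_top) x (fun i hi => ?_)
    fun i hi hik => ?_
  · rw [norm_iteratedFDeriv_eq_norm_iteratedDeriv]
    exact hfx i hi
  · rw [norm_iteratedFDeriv_eq_norm_iteratedDeriv, Real.norm_eq_abs]
    exact (hBφ i hi hik).trans (le_self_pow₀ hB (by omega))

theorem exists_bound_of_compact {ι : Type*} {s : Set ι} (hs : s.Finite) {f : ι → ℝ → 𝕜}
    (hf : ∀ i, ContDiff ℝ ∞ (f i)) {I : Set ℝ} (hI : IsCompact I) (m : ℕ) :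
    ∃ C : ℝ, ∀ i ∈ s, ∀ k ≤ m, ∀ y ∈ I, ‖iteratedDeriv k (f i) y‖ ≤ C := by
  have h1 : ∀ p : ι × ℕ, ∃ C : ℝ, ∀ y ∈ I, ‖iteratedDeriv p.2 (f p.1) y‖ ≤ C := fun p =>
    hI.exists_bound_of_continuousOn
      ((hf p.1).continuous_iteratedDeriv p.2 (by exact_mod_cast le_top)).continuousOn
  choose C hC using h1
  obtain ⟨M, hM⟩ := ((hs.prod (Set.finite_Iic m)).image C).bddAbove
  exact ⟨M, fun i hi k hk y hy => (hC (i, k) y hy).trans (hM ⟨(i, k), ⟨hi, hk⟩, rfl⟩)⟩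

/-! ### Fixed-point free increasing bijections of the line -/

theorem tendsto_iterate_atTop {ψ : ℝ → ℝ} (hc : Continuous ψ) (hψ : ∀ x, x < ψ x) (x : ℝ) :
    Tendsto (fun n => ψ^[n] x) atTop atTop := by
  have hm : Monotone fun n => ψ^[n] x := monotone_nat_of_le_succ fun n => by
    rw [Function.iterate_succ_apply']
    exact (hψ _).le
  rcases tendsto_atTop_of_monotone hm with h | ⟨l, hl⟩
  · exact h
  · exact absurd (isFixedPt_of_tendsto_iterate hl hc.continuousAt) (hψ l).ne'

theorem tendsto_iterate_atBot {ψ : ℝ → ℝ} (hc : Continuous ψ) (hψ : ∀ x, ψ x < x) (x : ℝ) :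
    Tendsto (fun n => ψ^[n] x) atTop atBot := by
  have hm : Antitone fun n => ψ^[n] x := antitone_nat_of_succ_le fun n => by
    rw [Function.iterate_succ_apply']
    exact (hψ _).le
  rcases tendsto_atTop_of_antitone hm with h | ⟨l, hl⟩
  · exact h
  · exact absurd (isFixedPt_of_tendsto_iterate hl hc.continuousAt) (hψ l).ne

theorem lt_or_gt_of_no_fixedPoint {ψ : ℝ → ℝ} (hc : Continuous ψ) (hψ : ∀ x, ψ x ≠ x) :
    (∀ x, x < ψ x) ∨ ∀ x, ψ x < x := by
  by_contra hcon
  push Not at hcon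
  obtain ⟨⟨a, ha⟩, b, hb⟩ := hcon
  obtain ⟨c, hc⟩ := mem_range_of_exists_le_of_exists_ge (c := 0) (hc.sub continuous_id)
    ⟨a, sub_nonpos.2 ha⟩ ⟨b, sub_nonneg.2 hb⟩
  exact hψ c (sub_eq_zero.1 hc)

/-- A decreasing `ψ` would reverse the inequality between `x` and `ψ x`, whereas this inequality has
the same direction at every point. -/
theorem strictMono_of_no_fixedPoint {ψ : ℝ → ℝ} (hc : Continuous ψ) (hi : Function.Injective ψ)
    (hψ : ∀ x, ψ x ≠ x) : StrictMono ψ := by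
  rcases hc.strictMono_of_inj hi with h | h
  · exact h
  · rcases lt_or_gt_of_no_fixedPoint hc hψ with h' | h'
    · exact absurd (h (h' 0)) (h' (ψ 0)).not_gt
    · exact absurd (h (h' 0)) (h' (ψ 0)).not_gt

/-- A smooth increasing bijection `ψ` of the line without fixed points, with smooth inverse `θ`. -/
structure IsFlow (ψ θ : ℝ → ℝ) : Prop where
  left_inv : Function.LeftInverse θ ψ
  right_inv : Function.RightInverse θ ψ
  contDiff : ContDiff ℝ ∞ ψ
  contDiff_inv : ContDiff ℝ ∞ θ
  strictMono : StrictMono ψ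
  ne : ∀ x, ψ x ≠ x

namespace IsFlow

variable {ψ θ : ℝ → ℝ}

theorem symm (h : IsFlow ψ θ) : IsFlow θ ψ where
  left_inv := h.right_inv
  right_inv := h.left_inv
  contDiff := h.contDiff_inv
  contDiff_inv := h.contDiff
  strictMono x y hxy := by
    rw [← h.strictMono.lt_iff_lt, h.right_inv x, h.right_inv y]
    exact hxy
  ne x hx := h.ne x (by
    conv_lhs => rw [← hx]
    exact h.right_inv x)

theorem contDiff_iterate (h : IsFlow ψ θ) (n : ℕ) : ContDiff ℝ ∞ ψ^[n] := by
  induction n with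
  | zero => exact contDiff_id
  | succ n ih => exact ih.comp h.contDiff

theorem inv_iterate (h : IsFlow ψ θ) (n : ℕ) (x : ℝ) : θ^[n] (ψ^[n] x) = x :=
  h.left_inv.iterate n x

/-- Once the orbit of one endpoint of `[-R, R]` has passed the other, monotonicity moves the whole
interval off itself. -/
theorem escape (h : IsFlow ψ θ) (R : ℝ) :
    ∀ᶠ n in atTop, ∀ x, |ψ^[n] x| ≤ R → R < |x| := by
  rcases lt_or_gt_of_no_fixedPoint h.contDiff.continuous h.ne with h' | h'
  · filter_upwards [(tendsto_iterate_atTop h.contDiff.continuous h' (-R)).eventually_gt_atTop R]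
      with n hn x hx
    by_contra hc
    push Not at hc
    have h1 := (h.strictMono.iterate n).monotone (abs_le.1 hc).1
    linarith [(abs_le.1 hx).2]
  · filter_upwards [(tendsto_iterate_atBot h.contDiff.continuous h' R).eventually_lt_atBot (-R)]
      with n hn x hx
    by_contra hc
    push Not at hc
    have h1 := (h.strictMono.iterate n).monotone (abs_le.1 hc).2
    linarith [(abs_le.1 hx).1]

theorem escape_Icc (h : IsFlow ψ θ) (a b R : ℝ) :
    ∀ᶠ n in atTop, ∀ x, ψ^[n] x ∈ Set.Icc a b → R < |x| := by
  filter_upwards [h.escape (max R (max |a| |b|))] with n hn x hx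
  refine lt_of_le_of_lt (le_max_left _ _) (hn x ?_)
  exact (abs_le_max_abs_abs hx.1 hx.2).trans (le_max_right _ _)

/-- `[a, ψ a]` is a fundamental domain: the first iterate to cross an end of it cannot jump over it.
By monotonicity the orbits of `-R` and `R` bound the number of steps. -/
theorem exists_cover_of_lt (h : IsFlow ψ θ) (hlt : ∀ x, x < ψ x) (a R : ℝ) :
    ∃ J : ℕ, ∀ y, |y| ≤ R → ∃ j ≤ J, ψ^[j] y ∈ Set.Icc a (ψ a) ∨ θ^[j] y ∈ Set.Icc a (ψ a) := by
  have hgt : ∀ x, θ x < x := fun x => by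
    have := hlt (θ x)
    rwa [h.right_inv x] at this
  obtain ⟨J₁, hJ₁⟩ :=
    ((tendsto_iterate_atTop h.contDiff.continuous hlt (-R)).eventually_ge_atTop a).exists
  obtain ⟨J₂, hJ₂⟩ :=
    ((tendsto_iterate_atBot h.contDiff_inv.continuous hgt R).eventually_le_atBot (ψ a)).exists
  classical
  refine ⟨max J₁ J₂, fun y hy => ?_⟩
  rcases le_total y a with hya | hya
  · have hex : ∃ j, a ≤ ψ^[j] y :=
      ⟨J₁, hJ₁.trans ((h.strictMono.iterate J₁).monotone (abs_le.1 hy).1)⟩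
    refine ⟨Nat.find hex, (Nat.find_min' hex
      (hJ₁.trans ((h.strictMono.iterate J₁).monotone (abs_le.1 hy).1))).trans (le_max_left _ _),
      Or.inl ⟨Nat.find_spec hex, ?_⟩⟩
    rcases Nat.eq_zero_or_eq_succ_pred (Nat.find hex) with h0 | h0
    · rw [h0]
      exact hya.trans (hlt a).le
    · have := Nat.find_min hex (m := (Nat.find hex).pred) (by omega)
      rw [h0, Function.iterate_succ_apply']
      exact h.strictMono.monotone (not_le.1 this).le
  · have hJy := ((h.symm.strictMono.iterate J₂).monotone (abs_le.1 hy).2).trans hJ₂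
    have hex : ∃ j, θ^[j] y ≤ ψ a := ⟨J₂, hJy⟩
    refine ⟨Nat.find hex, (Nat.find_min' hex hJy).trans (le_max_right _ _),
      Or.inr ⟨?_, Nat.find_spec hex⟩⟩
    rcases Nat.eq_zero_or_eq_succ_pred (Nat.find hex) with h0 | h0
    · rw [h0]
      exact hya
    · have := Nat.find_min hex (m := (Nat.find hex).pred) (by omega)
      rw [h0, Function.iterate_succ_apply']
      refine (h.left_inv a).symm.le.trans ?_
      exact h.symm.strictMono.monotone (not_le.1 this).le

theorem exists_cover (h : IsFlow ψ θ) (a R : ℝ) :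
    ∃ J : ℕ, ∀ y, |y| ≤ R → ∃ j ≤ J,
      ψ^[j] y ∈ Set.Icc (min a (ψ a)) (max a (ψ a)) ∨
      θ^[j] y ∈ Set.Icc (min a (ψ a)) (max a (ψ a)) := by
  rcases lt_or_gt_of_no_fixedPoint h.contDiff.continuous h.ne with h' | h'
  · rw [min_eq_left (h' a).le, max_eq_right (h' a).le]
    exact h.exists_cover_of_lt h' a R
  · rw [min_eq_right (h' a).le, max_eq_left (h' a).le]
    -- For the inverse, the interval based at `ψ a` is `[ψ a, θ (ψ a)] = [ψ a, a]`.
    obtain ⟨J, hJ⟩ := h.symm.exists_cover_of_lt (fun x => by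
      have := h' (θ x)
      rwa [h.right_inv x] at this) (ψ a) R
    rw [h.left_inv a] at hJ
    exact ⟨J, fun y hy => (hJ y hy).imp fun j hj => ⟨hj.1, hj.2.symm⟩⟩

/-- Under the polynomial bounds, the functions `f ∘ ψₙ` tend to zero for every test function. -/
theorem tendsto_comp_iterate (h : IsFlow ψ θ) {a : ℝ}
    (hb : PolyBound (fun n => ψ^[n]) (Set.Icc (min a (ψ a)) (max a (ψ a))))
    {f : ℝ → 𝕜} (hf : ContDiff ℝ ∞ f) (hfc : HasCompactSupport f) {F : ℕ → OM 𝕜}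
    (hF : ∀ n, (F n).1 = f ∘ ψ^[n]) : Tendsto F atTop (𝓝 0) := by
  set I := Set.Icc (min a (ψ a)) (max a (ψ a)) with hI
  obtain ⟨R, hR⟩ : ∃ R : ℝ, ∀ y, R < |y| → f y = 0 := by
    obtain ⟨R, hR⟩ := hfc.isCompact.isBounded.exists_norm_le
    refine ⟨R, fun y hy => ?_⟩
    by_contra hne
    exact absurd (hR y (subset_tsupport f hne)) (not_le.2 hy)
  refine OM.tendsto_zero (fun m => ?_) fun r => ?_
  · obtain ⟨J, hJ⟩ := h.exists_cover a R
    obtain ⟨N, C, hC1, hC⟩ := exists_uniform_polyBound m fun k hk _ => hb k hk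
    obtain ⟨C₁, hC₁⟩ := exists_bound_of_compact (Set.finite_Iic J) (f := fun j => f ∘ θ^[j])
      (fun j => hf.comp (h.symm.contDiff_iterate j)) (isCompact_Icc (a := min a (ψ a))
        (b := max a (ψ a))) m
    obtain ⟨C₂, hC₂⟩ := exists_bound_of_compact (Set.finite_Iic J) (f := fun j => f ∘ ψ^[j])
      (fun j => hf.comp (h.contDiff_iterate j)) (isCompact_Icc (a := min a (ψ a))
        (b := max a (ψ a))) m
    obtain ⟨n₀, hn₀⟩ := eventually_atTop.1 hC
    have hM : 0 ≤ max (max C₁ C₂) 0 := le_max_right _ _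
    refine ⟨N * m, m.factorial * max (max C₁ C₂) 0 * C ^ m, ?_⟩
    filter_upwards [eventually_ge_atTop (n₀ + J)] with n hn k hk x
    have h0 : (1 : ℝ) ≤ 1 + |x| ^ 2 := by nlinarith [sq_nonneg |x|]
    have hB : 1 ≤ C * (1 + |x| ^ 2) ^ N :=
      one_le_mul_of_one_le_of_one_le hC1 (one_le_pow₀ h0)
    -- The bounds hold only where the iterate lands in `I`, so `f ∘ ψ^[n]` is refactored through `i
    -- = n + j` or `i = n - j` with `j ≤ J`. Finitely many outer functions `g` occur, and `n ≥ n₀ +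
    -- J` keeps `i ≥ n₀`.
    have key : ∀ (i : ℕ) (g : ℝ → 𝕜), n₀ ≤ i → ContDiff ℝ ∞ g → f ∘ ψ^[n] = g ∘ ψ^[i] →
        ψ^[i] x ∈ I → (∀ j ≤ m, ∀ y ∈ I, ‖iteratedDeriv j g y‖ ≤ max (max C₁ C₂) 0) →
        ‖iteratedDeriv k (f ∘ ψ^[n]) x‖ ≤
          m.factorial * max (max C₁ C₂) 0 * C ^ m * (1 + |x| ^ 2) ^ (N * m) := by
      intro i g hi hg hfg hx hgI
      rw [hfg]
      refine (norm_iteratedDeriv_comp_le (h.contDiff_iterate i) hg hB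
        (fun l hl hlk => hn₀ i hi l hl (hlk.trans hk) x hx)
        (fun j hj => hgI j (hj.trans hk) _ hx)).trans ?_
      rw [pow_mul, mul_assoc, mul_assoc, mul_assoc, ← mul_pow]
      gcongr
    rw [hF]
    by_cases hx : |ψ^[n] x| ≤ R
    · obtain ⟨j, hj, hjI | hjI⟩ := hJ _ hx
      · refine key (n + j) (f ∘ θ^[j]) (by omega) (hf.comp (h.symm.contDiff_iterate j)) ?_ ?_
          fun l hl y hy => (hC₁ j hj l hl y hy).trans ((le_max_left _ _).trans (le_max_left _ _))
        · ext y
          simp only [Function.comp_apply]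
          rw [add_comm, Function.iterate_add_apply, h.inv_iterate]
        · rw [add_comm, Function.iterate_add_apply]
          exact hjI
      · have hnj : ψ^[n] = ψ^[j] ∘ ψ^[n - j] := by
          rw [← Function.iterate_add]
          congr 1
          omega
        refine key (n - j) (f ∘ ψ^[j]) (by omega) (hf.comp (h.contDiff_iterate j)) ?_ ?_
          fun l hl y hy => (hC₂ j hj l hl y hy).trans ((le_max_right _ _).trans (le_max_left _ _))
        · rw [hnj]
          rfl
        · rwa [hnj, Function.comp_apply, h.inv_iterate] at hjI
    · rw [iteratedDeriv_eq_zero_of_eqOn_zero (f := f ∘ ψ^[n])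
        (s := {x | R < |ψ^[n] x|})
        (isOpen_lt continuous_const (h.contDiff_iterate n).continuous.abs)
        (fun y hy => hR _ hy) k (not_le.1 hx), norm_zero]
      positivity
  · filter_upwards [h.escape (max r R)] with n hn x hx
    rw [hF]
    refine hR _ ?_
    by_contra hc
    have := hn x ((not_lt.1 hc).trans (le_max_right _ _))
    exact absurd ((le_max_left r R).trans this.le) (not_le.2 hx)

end IsFlow

/-! ### Density of compactly supported functions. -/

/-- Elements of `𝒪_M(ℝ)` from compactly supported smooth functions. -/
def OM.ofCompactSupport {f : ℝ → 𝕜} (hf : ContDiff ℝ ∞ f) (hc : HasCompactSupport f) : OM 𝕜 :=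
  ⟨f, mem_slowlyIncreasing_iff.2 (hc.hasTemperateGrowth hf)⟩

/-- Compactly supported smooth functions are dense in `𝒪_M(ℝ)`. -/
theorem OM.exists_hasCompactSupport_mem {U : Set (OM 𝕜)} (hU : IsOpen U) (hne : U.Nonempty) :
    ∃ g ∈ U, HasCompactSupport g.1 := by
  obtain ⟨f, hfU⟩ := hne
  let b : ContDiffBump (0 : ℝ) := ⟨1, 2, one_pos, one_lt_two⟩
  let φ : 𝓢(ℝ, ℝ) := b.hasCompactSupport.toSchwartzMap b.contDiff
  let c : ℕ → ℝ := fun n => ((n : ℝ) + 1)⁻¹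
  have hc0 : ∀ n, 0 < c n := fun n => by positivity
  have hc1 : ∀ n, c n ≤ 1 := fun n => inv_le_one_of_one_le₀ (by
    have : (0 : ℝ) ≤ n := by positivity
    linarith)
  have hbs : ∀ n, ContDiff ℝ ∞ fun x => b (c n * x) := fun n =>
    b.contDiff.comp (contDiff_const.mul contDiff_id)
  have hGs : ∀ n, ContDiff ℝ ∞ fun x => b (c n * x) • f.1 x := fun n => (hbs n).smul f.contDiff
  have hGc : ∀ n, HasCompactSupport fun x => b (c n * x) • f.1 x := fun n =>
    (b.hasCompactSupport.comp_homeomorph (Homeomorph.mulLeft₀ (c n) (hc0 n).ne')).smul_right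
  let G : ℕ → OM 𝕜 := fun n => OM.ofCompactSupport (hGs n) (hGc n)
  -- The dilation factors `c n ≤ 1` keep all derivatives of the cutoffs bounded uniformly in `n`,
  -- and the cutoffs equal `1` on growing intervals.
  have hlim : Tendsto (fun n => G n - f) atTop (𝓝 0) := by
    refine OM.tendsto_zero (fun m => ?_) fun R => ?_
    · obtain ⟨N, -, C, hC⟩ := (Submodule.mem_iInf _).1 f.2 m
      have hC0 : 0 ≤ C := le_trans (by positivity) (hC 0 0 (Nat.zero_le _))
      have hC' : ∀ x, ∀ j ≤ m, ‖iteratedDeriv j f.1 x‖ ≤ (1 + |x| ^ 2) ^ N * C := fun x j hj => by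
        rw [← inv_mul_le_iff₀ (by positivity)]
        exact hC x j hj
      choose B hB0 hB using fun i => φ.decay 0 i
      let M := ∑ i ∈ Finset.range (m + 1), B i
      have hM : ∀ i ≤ m, ∀ x, ‖iteratedDeriv i b x‖ ≤ M := fun i hi x => by
        have h1 := hB i x
        rw [pow_zero, one_mul, norm_iteratedFDeriv_eq_norm_iteratedDeriv] at h1
        exact h1.trans (Finset.single_le_sum (fun j _ => (hB0 j).le)
          (Finset.mem_range.2 (Nat.lt_succ_of_le hi)))
      have hM0 : 0 ≤ M := Finset.sum_nonneg fun j _ => (hB0 j).le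
      refine ⟨N, 2 ^ m * M * C + C, Eventually.of_forall fun n k hk x => ?_⟩
      have hk' : ((k : ℕ) : WithTop ℕ∞) ≤ ∞ := by exact_mod_cast le_top
      have h1 := norm_iteratedFDeriv_smul_le (hbs n) f.contDiff x hk'
      rw [norm_iteratedFDeriv_eq_norm_iteratedDeriv] at h1
      have h2 : ‖iteratedDeriv k (fun x => b (c n * x) • f.1 x) x‖ ≤
          2 ^ m * M * C * (1 + |x| ^ 2) ^ N := by
        refine h1.trans ?_
        calc _ ≤ ∑ i ∈ Finset.range (k + 1), (k.choose i : ℝ) * M * ((1 + |x| ^ 2) ^ N * C) := by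
              refine Finset.sum_le_sum fun i hi => ?_
              have hik : i ≤ k := Nat.lt_succ_iff.1 (Finset.mem_range.1 hi)
              rw [norm_iteratedFDeriv_eq_norm_iteratedDeriv,
                norm_iteratedFDeriv_eq_norm_iteratedDeriv]
              gcongr
              · rw [iteratedDeriv_comp_const_mul b.contDiff, norm_mul, norm_pow,
                  Real.norm_of_nonneg (hc0 n).le]
                calc c n ^ i * ‖iteratedDeriv i b (c n * x)‖ ≤ 1 * M := by
                      gcongr
                      · exact pow_le_one₀ (hc0 n).le (hc1 n)
                      · exact hM i (hik.trans hk) _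
                  _ = M := one_mul M
              · exact hC' x _ (by omega)
          _ = 2 ^ k * M * C * (1 + |x| ^ 2) ^ N := by
              rw [← Finset.sum_mul, ← Finset.sum_mul]
              have := Nat.sum_range_choose k
              have h3 : (∑ i ∈ Finset.range (k + 1), (k.choose i : ℝ)) = 2 ^ k := by
                exact_mod_cast this
              rw [h3]
              ring
          _ ≤ _ := by
              gcongr
              norm_num
      change ‖iteratedDeriv k ((fun x => b (c n * x) • f.1 x) - f.1) x‖ ≤ _
      rw [iteratedDeriv_sub ((hGs n).of_le hk').contDiffAt (f.contDiff.of_le hk').contDiffAt]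
      refine (norm_sub_le _ _).trans ?_
      have := hC' x k hk
      linarith
    · obtain ⟨n₀, hn₀⟩ := exists_nat_gt R
      filter_upwards [eventually_ge_atTop n₀] with n hn x hx
      change b (c n * x) • f.1 x - f.1 x = 0
      rw [b.one_of_mem_closedBall, one_smul, sub_self]
      rw [mem_closedBall_zero_iff, norm_mul, Real.norm_of_nonneg (hc0 n).le, Real.norm_eq_abs]
      change ((n : ℝ) + 1)⁻¹ * |x| ≤ 1
      rw [inv_mul_le_iff₀ (by positivity)]
      have : (n₀ : ℝ) ≤ n := by exact_mod_cast hn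
      linarith
  have hlim' : Tendsto G atTop (𝓝 f) := by
    simpa using hlim.add_const f
  obtain ⟨n, hn⟩ := (hlim'.eventually (hU.mem_nhds hfU)).exists
  exact ⟨G n, hn, hGc n⟩

/-! ### Iterates of the composition operator -/

variable {ψ θ : ℝ → ℝ}

theorem compOp_iterate (hψ : ψ ∈ slowlyIncreasing ℝ) (n : ℕ) (f : OM 𝕜) :
    ((compOp 𝕜 ψ hψ)^[n] f).1 = f.1 ∘ ψ^[n] := by
  induction n with
  | zero => rfl
  | succ n ih =>
    rw [Function.iterate_succ_apply']
    change ((compOp 𝕜 ψ hψ)^[n] f).1 ∘ ψ = _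
    rw [ih, Function.iterate_succ]
    rfl

theorem isFlow_invFun (hψ : ψ ∈ slowlyIncreasing ℝ) (hsurj : Function.Surjective ψ)
    (hinj : Function.Injective ψ) (hd : ∀ x, deriv ψ x ≠ 0) (hfix : ∀ x, ψ x ≠ x) :
    IsFlow ψ (Function.invFun ψ) := by
  have hs : ContDiff ℝ ∞ ψ := (mem_slowlyIncreasing_iff.1 hψ).1
  have hm : StrictMono ψ := strictMono_of_no_fixedPoint hs.continuous hinj hfix
  refine ⟨Function.leftInverse_invFun hinj, Function.rightInverse_invFun hsurj, hs, ?_, hm, hfix⟩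
  let e : ℝ ≃ₜ ℝ := (hm.orderIsoOfSurjective ψ hsurj).toHomeomorph
  have he : ⇑e = ψ := rfl
  have h1 : ContDiff ℝ ∞ e.symm := e.contDiff_symm_deriv hd
    (fun x => (hs.differentiable (by simp) x).hasDerivAt) hs
  have h2 : Function.invFun ψ = e.symm := by
    ext x
    apply hinj
    rw [Function.rightInverse_invFun hsurj x]
    exact (e.apply_symm_apply x).symm
  rwa [h2]

theorem zIter_neg (h : IsFlow ψ θ) (n : ℕ) : zIter ψ (-n) = θ^[n] := by
  cases n with
  | zero => rfl
  | succ n =>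
    change Function.invFun ψ^[n + 1] = _
    ext x
    refine (h.strictMono.iterate (n + 1)).injective ?_
    rw [h.symm.inv_iterate]
    exact Function.rightInverse_invFun
      (fun y => ⟨θ^[n + 1] y, h.symm.inv_iterate (n + 1) y⟩) x

theorem IsFlow.image_iterate (h : IsFlow ψ θ) (n : ℕ) (I : Set ℝ) : ψ^[n] '' I = θ^[n] ⁻¹' I :=
  congrFun (Set.image_eq_preimage_of_inverse (h.inv_iterate n) (h.symm.inv_iterate n)) I

theorem forwardDecay_iff_polyBound (𝕜 : Type*) [RCLike 𝕜] (h : IsFlow ψ θ) (a : ℝ) :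
    (∀ k : ℕ, 1 ≤ k → ∀ v : 𝓢(ℝ, 𝕜), ForwardDecay ψ a k v) ↔
      PolyBound (fun n => ψ^[n]) (Set.Icc (min a (ψ a)) (max a (ψ a))) := by
  rw [← tendsto_weightedSup_iff_polyBound 𝕜 (h.escape_Icc _ _)]
  simp only [ForwardDecay, zIter_neg h, h.symm.image_iterate]
  rfl

theorem backwardDecay_iff_polyBound (𝕜 : Type*) [RCLike 𝕜] (h : IsFlow ψ θ) (a : ℝ) :
    (∀ k : ℕ, 1 ≤ k → ∀ v : 𝓢(ℝ, 𝕜), BackwardDecay ψ a k v) ↔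
      PolyBound (fun n => θ^[n]) (Set.Icc (min a (ψ a)) (max a (ψ a))) := by
  rw [← tendsto_weightedSup_iff_polyBound 𝕜 (h.symm.escape_Icc _ _)]
  simp only [BackwardDecay, zIter_neg h, ← h.image_iterate]
  rfl

/-- The inverse `θ` need not lie in `𝒪_M(ℝ)`; the right inverses `w ↦ w ∘ θ^[n]` are used only on
compactly supported `w`. -/
theorem isMixing_of_polyBound (hψ : ψ ∈ slowlyIncreasing ℝ) (h : IsFlow ψ θ) {a b : ℝ}
    (ha : PolyBound (fun n => ψ^[n]) (Set.Icc (min a (ψ a)) (max a (ψ a))))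
    (hb : PolyBound (fun n => θ^[n]) (Set.Icc (min b (ψ b)) (max b (ψ b)))) :
    IsMixing (compOp 𝕜 ψ hψ) := by
  intro U V hU hV hUne hVne
  obtain ⟨u, huU, huc⟩ := OM.exists_hasCompactSupport_mem hU hUne
  obtain ⟨w, hwV, hwc⟩ := OM.exists_hasCompactSupport_mem hV hVne
  have hSc : ∀ n, HasCompactSupport (w.1 ∘ θ^[n]) := fun n => by
    refine HasCompactSupport.intro
      (hwc.isCompact.image (h.contDiff_iterate n).continuous) fun x hx => ?_
    by_contra hne
    exact hx ⟨θ^[n] x, subset_tsupport _ hne, h.symm.inv_iterate n x⟩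
  let S : ℕ → OM 𝕜 := fun n =>
    OM.ofCompactSupport (w.contDiff.comp (h.symm.contDiff_iterate n)) (hSc n)
  have hS : Tendsto S atTop (𝓝 0) := by
    -- Based at `ψ b`, the interval of `θ` has endpoints `ψ b` and `θ (ψ b) = b`, so it is `I_b`.
    refine h.symm.tendsto_comp_iterate (a := ψ b) ?_ w.contDiff hwc fun n => rfl
    rw [h.left_inv b, min_comm, max_comm]
    exact hb
  have hT : Tendsto (fun n => (compOp 𝕜 ψ hψ)^[n] u) atTop (𝓝 0) :=
    h.tendsto_comp_iterate ha u.contDiff huc fun n => compOp_iterate hψ n u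
  have h1 : Tendsto (fun n => u + S n) atTop (𝓝 u) := by simpa using hS.const_add u
  have h2 : Tendsto (fun n => (compOp 𝕜 ψ hψ)^[n] u + w) atTop (𝓝 w) := by
    simpa using hT.add_const w
  obtain ⟨N, hN⟩ := eventually_atTop.1
    ((h1.eventually (hU.mem_nhds huU)).and (h2.eventually (hV.mem_nhds hwV)))
  refine ⟨N, fun n hn => ⟨_, ⟨u + S n, (hN n hn).1, rfl⟩, ?_⟩⟩
  suffices heq : (compOp 𝕜 ψ hψ)^[n] (u + S n) = (compOp 𝕜 ψ hψ)^[n] u + w by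
    rw [heq]
    exact (hN n hn).2
  apply Subtype.ext
  change _ = ((compOp 𝕜 ψ hψ)^[n] u).1 + w.1
  rw [compOp_iterate, compOp_iterate]
  ext x
  change u.1 (ψ^[n] x) + w.1 (θ^[n] (ψ^[n] x)) = u.1 (ψ^[n] x) + w.1 x
  rw [h.inv_iterate]

/-! ### Consequences of mixing -/

/-- The identity function as an element of `𝒪_M(ℝ)`. -/
def OM.coordinate (𝕜 : Type*) [RCLike 𝕜] : OM 𝕜 :=
  ⟨((↑) : ℝ → 𝕜),
    mem_slowlyIncreasing_iff.2 (RCLike.ofRealCLM (K := 𝕜)).hasTemperateGrowth⟩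

/-- The constant function `1` as an element of `𝒪_M(ℝ)`. -/
def OM.one (𝕜 : Type*) [RCLike 𝕜] : OM 𝕜 :=
  ⟨fun _ => 1, mem_slowlyIncreasing_iff.2 (.const 1)⟩

/-- Under mixing, weighted neighbourhoods of any two elements are eventually connected. -/
theorem IsMixing.exists_comp {hψ : ψ ∈ slowlyIncreasing ℝ} (h : IsMixing (compOp 𝕜 ψ hψ))
    {w₁ w₂ : ℝ → ℝ} (hw₁ : IsRapid w₁) (hw₂ : IsRapid w₂) (m : ℕ) (f₁ f₂ : OM 𝕜) {ε : ℝ}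
    (hε : 0 < ε) :
    ∀ᶠ n in atTop, ∃ f : OM 𝕜,
      (∀ j ≤ m, ∀ x, w₁ x * ‖iteratedDeriv j (f.1 - f₁.1) x‖ < ε) ∧
      ∀ j ≤ m, ∀ x, w₂ x * ‖iteratedDeriv j (f.1 ∘ ψ^[n] - f₂.1) x‖ < ε := by
  obtain ⟨U, hU, hfU, hU'⟩ := OM.exists_isOpen hw₁ m f₁ hε
  obtain ⟨V, hV, hfV, hV'⟩ := OM.exists_isOpen hw₂ m f₂ hε
  obtain ⟨N, hN⟩ := h U V hU hV ⟨_, hfU⟩ ⟨_, hfV⟩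
  filter_upwards [eventually_ge_atTop N] with n hn
  obtain ⟨_, ⟨f, hf, rfl⟩, hfV⟩ := hN n hn
  refine ⟨f, hU' f hf, ?_⟩
  rw [← compOp_iterate hψ]
  exact hV' _ hfV

theorem indicator_Icc_eq_one {x R : ℝ} (h : |x| ≤ R) :
    Set.indicator (Set.Icc (-R) R) (1 : ℝ → ℝ) x = 1 :=
  Set.indicator_of_mem (s := Set.Icc (-R) R) (abs_le.1 h) _

/-- If `ψ x = ψ y`, then `f ∘ ψ^[n]` with `n ≥ 1` agrees at `x` and `y`, so it cannot be within `|x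
- y| / 2` of the coordinate function at both. -/
theorem IsMixing.injective {hψ : ψ ∈ slowlyIncreasing ℝ} (h : IsMixing (compOp 𝕜 ψ hψ)) :
    Function.Injective ψ := by
  intro x y hxy
  by_contra hne
  have hε : 0 < |x - y| / 2 := by
    have := abs_pos.2 (sub_ne_zero.2 hne)
    positivity
  obtain ⟨n, ⟨f, -, hf⟩, hn⟩ := ((h.exists_comp (isRapid_indicator (max |x| |y|))
    (isRapid_indicator (max |x| |y|)) 0 0 (OM.coordinate 𝕜) hε).and (eventually_ge_atTop 1)).exists
  have hx := hf 0 le_rfl x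
  have hy := hf 0 le_rfl y
  rw [indicator_Icc_eq_one (le_max_left |x| |y|), one_mul,
    iteratedDeriv_zero] at hx
  rw [indicator_Icc_eq_one (le_max_right |x| |y|), one_mul,
    iteratedDeriv_zero] at hy
  change ‖f.1 (ψ^[n] x) - (x : 𝕜)‖ < _ at hx
  change ‖f.1 (ψ^[n] y) - (y : 𝕜)‖ < _ at hy
  obtain ⟨n, rfl⟩ := Nat.exists_eq_succ_of_ne_zero (by omega : n ≠ 0)
  rw [Function.iterate_succ_apply, hxy] at hx
  rw [Function.iterate_succ_apply] at hy
  have h1 : ‖(x : 𝕜) - (y : 𝕜)‖ = |x - y| := by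
    rw [← RCLike.ofReal_sub, RCLike.norm_ofReal]
  have h2 := norm_sub_le_norm_sub_add_norm_sub (x : 𝕜) (f.1 (ψ^[n] (ψ y))) (y : 𝕜)
  rw [h1, norm_sub_rev (x : 𝕜)] at h2
  linarith

/-- At a critical point of `ψ`, every `f ∘ ψ^[n]` with `n ≥ 1` has derivative zero, at distance `1`
from that of the coordinate function. -/
theorem IsMixing.deriv_ne_zero {hψ : ψ ∈ slowlyIncreasing ℝ} (h : IsMixing (compOp 𝕜 ψ hψ))
    (x : ℝ) : deriv ψ x ≠ 0 := by
  intro hx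
  have hs : ContDiff ℝ ∞ ψ := (mem_slowlyIncreasing_iff.1 hψ).1
  obtain ⟨n, ⟨f, -, hf⟩, hn⟩ := ((h.exists_comp (isRapid_indicator |x|)
    (isRapid_indicator |x|) 1 0 (OM.coordinate 𝕜) one_pos).and (eventually_ge_atTop 1)).exists
  have h1 := hf 1 le_rfl x
  rw [indicator_Icc_eq_one (le_refl |x|), one_mul, iteratedDeriv_one] at h1
  obtain ⟨n, rfl⟩ := Nat.exists_eq_succ_of_ne_zero (by omega : n ≠ 0)
  have h2 : HasDerivAt ψ 0 x := hx ▸ (hs.differentiable (by simp) x).hasDerivAt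
  have hg : ContDiff ℝ ∞ (f.1 ∘ ψ^[n]) := by
    rw [← compOp_iterate hψ]
    exact OM.contDiff _
  have h3 : HasDerivAt (f.1 ∘ ψ^[n + 1]) 0 x := by
    have := ((hg.differentiable (by simp) (ψ x)).hasDerivAt).scomp x h2
    rw [zero_smul] at this
    exact this
  have h4 : HasDerivAt (OM.coordinate 𝕜).1 1 x := by
    have := (RCLike.ofRealCLM (K := 𝕜)).hasDerivAt (x := x)
    rw [RCLike.ofRealCLM_apply, RCLike.ofReal_one] at this
    exact this
  rw [(h3.sub h4).deriv] at h1
  simp at h1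

/-- At a fixed point `f` and `f ∘ ψ^[n]` agree, so they cannot be within `1/2` of `0` and `1`
respectively. -/
theorem IsMixing.ne_self {hψ : ψ ∈ slowlyIncreasing ℝ} (h : IsMixing (compOp 𝕜 ψ hψ))
    (x : ℝ) : ψ x ≠ x := by
  intro hx
  obtain ⟨n, f, hf0, hf1⟩ := (h.exists_comp (isRapid_indicator |x|)
    (isRapid_indicator |x|) 0 0 (OM.one 𝕜) one_half_pos).exists
  have h0 := hf0 0 le_rfl x
  have h1 := hf1 0 le_rfl x
  rw [indicator_Icc_eq_one (le_refl |x|), one_mul, iteratedDeriv_zero] at h0 h1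
  change ‖f.1 x - 0‖ < _ at h0
  change ‖f.1 (ψ^[n] x) - 1‖ < _ at h1
  rw [Function.iterate_fixed hx] at h1
  have h2 := norm_sub_le (f.1 x - 0) (f.1 x - 1)
  rw [sub_sub_sub_cancel_left, sub_zero, norm_one] at h2
  linarith

theorem IsMixing.polyBound {hψ : ψ ∈ slowlyIncreasing ℝ} (h : IsMixing (compOp 𝕜 ψ hψ))
    (hF : IsFlow ψ θ) (a b : ℝ) : PolyBound (fun n => ψ^[n]) (Set.Icc a b) := by
  refine polyBound_of_approx 𝕜 hF.contDiff_iterate (hF.escape_Icc a b) fun k v δ hδ => ?_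
  filter_upwards [h.exists_comp (isRapid_indicator (max |a| |b|)) (isRapid_norm v) k
    (OM.coordinate 𝕜) 0 (lt_min hδ one_pos)] with n ⟨f, hf1, hf2⟩
  refine ⟨f.1, f.contDiff, fun j hj y hy => ?_, fun j hj x => ?_⟩
  · have h1 := hf1 j hj y
    rw [indicator_Icc_eq_one (abs_le_max_abs_abs hy.1 hy.2), one_mul] at h1
    exact h1.le.trans (min_le_left _ _)
  · have h1 := hf2 j hj x
    have h2 : f.1 ∘ ψ^[n] - (0 : OM 𝕜).1 = f.1 ∘ ψ^[n] := sub_zero _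
    rw [h2] at h1
    exact h1.le.trans (min_le_right _ _)

/-- The two neighbourhoods swap roles: `f ∘ ψ^[n]` is now close to the coordinate on the interval,
and composing it with `θ^[n]` returns `f`, which is small against `v`. -/
theorem IsMixing.polyBound_inv {hψ : ψ ∈ slowlyIncreasing ℝ} (h : IsMixing (compOp 𝕜 ψ hψ))
    (hF : IsFlow ψ θ) (a b : ℝ) : PolyBound (fun n => θ^[n]) (Set.Icc a b) := by
  refine polyBound_of_approx 𝕜 hF.symm.contDiff_iterate (hF.symm.escape_Icc a b) fun k v δ hδ => ?_
  filter_upwards [h.exists_comp (isRapid_norm v) (isRapid_indicator (max |a| |b|)) k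
    0 (OM.coordinate 𝕜) (lt_min hδ one_pos)] with n ⟨f, hf1, hf2⟩
  refine ⟨f.1 ∘ ψ^[n], f.contDiff.comp (hF.contDiff_iterate n), fun j hj y hy => ?_,
    fun j hj x => ?_⟩
  · have h1 := hf2 j hj y
    rw [indicator_Icc_eq_one (abs_le_max_abs_abs hy.1 hy.2), one_mul] at h1
    exact h1.le.trans (min_le_left _ _)
  · have h1 := hf1 j hj x
    have h2 : f.1 - (0 : OM 𝕜).1 = (f.1 ∘ ψ^[n]) ∘ θ^[n] := by
      ext y
      change f.1 y - 0 = f.1 (ψ^[n] (θ^[n] y))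
      rw [sub_zero, hF.symm.inv_iterate]
    rw [h2] at h1
    exact h1.le.trans (min_le_right _ _)

end SlowlyIncreasing

end

theorem theorem3p1 (𝕜 : Type*) [RCLike 𝕜] (ψ : ℝ → ℝ) (hψ : ψ ∈ slowlyIncreasing ℝ)
    (hsurj : Function.Surjective ψ) :
    List.TFAE
      [ IsMixing (compOp 𝕜 ψ hψ),
        Function.Injective ψ ∧ (∀ x, deriv ψ x ≠ 0) ∧ (∀ x, ψ x ≠ x) ∧
          ∀ a : ℝ, ∀ k : ℕ, 1 ≤ k → ∀ v : 𝓢(ℝ, 𝕜),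
            ForwardDecay ψ a k v ∧ BackwardDecay ψ a k v,
        Function.Injective ψ ∧ (∀ x, deriv ψ x ≠ 0) ∧ (∀ x, ψ x ≠ x) ∧
          ∃ a b : ℝ, ∀ k : ℕ, 1 ≤ k → ∀ v : 𝓢(ℝ, 𝕜),
            ForwardDecay ψ a k v ∧ BackwardDecay ψ b k v ] := by
  tfae_have 1 → 2 := by
    intro h
    have hF := isFlow_invFun hψ hsurj h.injective h.deriv_ne_zero h.ne_self
    exact ⟨h.injective, h.deriv_ne_zero, h.ne_self, fun a k hk v =>
      ⟨(forwardDecay_iff_polyBound 𝕜 hF a).2 (h.polyBound hF _ _) k hk v,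
        (backwardDecay_iff_polyBound 𝕜 hF a).2 (h.polyBound_inv hF _ _) k hk v⟩⟩
  tfae_have 2 → 3 := fun ⟨hi, hd, hfix, h⟩ => ⟨hi, hd, hfix, 0, 0, h 0⟩
  tfae_have 3 → 1 := by
    rintro ⟨hi, hd, hfix, a, b, h⟩
    have hF := isFlow_invFun hψ hsurj hi hd hfix
    exact isMixing_of_polyBound hψ hF
      ((forwardDecay_iff_polyBound 𝕜 hF a).1 fun k hk v => (h k hk v).1)
      ((backwardDecay_iff_polyBound 𝕜 hF b).1 fun k hk v => (h k hk v).2)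
  tfae_finish
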